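/- **Definitions.** A *(finitary) generalised algebraic theory* (GAT, in Cartmell's sense) $T$ consists of a set of sort symbols, each with an introductory rule $\Gamma_S \vdash S(x_1,\dots,x_n)\ \mathrm{type}$; a set of operator symbols, each with an introductory rule $\Gamma_f \vdash f(x_1,\dots,x_n) : A_f$; and a set of axioms of the forms $\Gamma \vdash A = B$ (equality of types) and $\Gamma \vdash s = t : A$ (equality of terms). All contexts are finite, and every introductory rule and every axiom is required to be well formed, i.e. derivable in the calculus of dependent types generated by the rules and axioms. $\mathrm{Alg}_T$ denotes the category of models of $T$ in sets: a model interprets each sort $S$ as a family of (small) sets indexed by the elements of the interpretation of $\Gamma_S$ and each operator as a dependent function, so that the axioms hold; a homomorphism is a family of functions between the sets interpreting the sorts that commutes with the operators (and agrees on types identified by the axioms). **Theorem.** Let $T \subset T'$ be an extension of GATs in which $T'$ adds operators and equations to $T$, but no new sorts. Then the forgetful functor $$U : \mathrm{Alg}_{T'} \to \mathrm{Alg}_T$$ has a right adjoint if and only if it commutes with finite colimits. -/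

import Mathlib

universe u

/-! # Generalised algebraic theories (with finite contexts) and their set-valued models -/

namespace GATheory

open CategoryTheory

/-! ## Raw expressions -/

/-- The symbols of a theory: sort symbols and operator symbols, each with a finite arity. -/
structure Signature : Type (u + 1) where
  Srt : Type u
  Op : Type u
  srtArity : Srt → ℕ
  opArity : Op → ℕ

/-- Raw terms in the variables `0, …, n - 1`. -/
inductive Term (σ : Signature.{u}) (n : ℕ) : Type u where
  | var (i : Fin n) : Term σ n
  | op (f : σ.Op) (args : Fin (σ.opArity f) → Term σ n) : Term σ n

/-- Raw types `S(t₁, …, tₖ)` in the variables `0, …, n - 1`. -/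
structure Ty (σ : Signature.{u}) (n : ℕ) : Type u where
  srt : σ.Srt
  args : Fin (σ.srtArity srt) → Term σ n

/-- Raw contexts `x₀ : Γ 0, …, xₙ₋₁ : Γ (n - 1)`. That `Γ i` only mentions variables before `i` is
part of the judgement that the context is well formed, see `Derivable.ctx_snoc`. -/
abbrev Ctx (σ : Signature.{u}) (n : ℕ) : Type u := Fin n → Ty σ n

/-- Simultaneous substitution in a term. -/
def Term.subst {σ : Signature.{u}} {m n : ℕ} (s : Fin m → Term σ n) : Term σ m → Term σ n
  | .var i => s i
  | .op f args => .op f fun j => (args j).subst s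

/-- Simultaneous substitution in a type. -/
def Ty.subst {σ : Signature.{u}} {m n : ℕ} (s : Fin m → Term σ n) (A : Ty σ m) : Ty σ n :=
  ⟨A.srt, fun j => (A.args j).subst s⟩

/-- A type in `n` variables, seen as a type in `n + 1` variables. -/
def Ty.weaken {σ : Signature.{u}} {n : ℕ} (A : Ty σ n) : Ty σ (n + 1) :=
  A.subst fun i => .var i.castSucc

/-- The raw context `Γ, xₙ : A`. -/
def Ctx.snoc {σ : Signature.{u}} {n : ℕ} (Γ : Ctx σ n) (A : Ty σ n) : Ctx σ (n + 1) :=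
  Fin.snoc (α := fun _ => Ty σ (n + 1)) (fun i => (Γ i).weaken) A.weaken

/-- A raw equation between types, `Γ ⊢ lhs = rhs`. -/
structure TyEqn (σ : Signature.{u}) : Type u where
  n : ℕ
  ctx : Ctx σ n
  lhs : Ty σ n
  rhs : Ty σ n

/-- A raw equation between terms, `Γ ⊢ lhs = rhs : ty`. -/
structure TmEqn (σ : Signature.{u}) : Type u where
  n : ℕ
  ctx : Ctx σ n
  ty : Ty σ n
  lhs : Term σ n
  rhs : Term σ n

/-- A pretheory: every sort symbol `S` has an introductory rule `srtCtx S ⊢ S(x₀, …) type`, every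
operator symbol `f` has an introductory rule `opCtx f ⊢ f(x₀, …) : opTy f`, and there are two sets
of axioms. Nothing is required to be well formed yet. -/
structure PreGAT : Type (u + 1) where
  sig : Signature.{u}
  srtCtx : ∀ S : sig.Srt, Ctx sig (sig.srtArity S)
  opCtx : ∀ f : sig.Op, Ctx sig (sig.opArity f)
  opTy : ∀ f : sig.Op, Ty sig (sig.opArity f)
  tyAx : Set (TyEqn sig)
  tmAx : Set (TmEqn sig)

/-! ## Derivations -/

/-- The forms of judgement. -/
inductive Judgment (σ : Signature.{u}) : Type u where
  /-- `Γ` is a context -/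
  | ctx {n : ℕ} (Γ : Ctx σ n) : Judgment σ
  /-- `Γ ⊢ A type` -/
  | ty {n : ℕ} (Γ : Ctx σ n) (A : Ty σ n) : Judgment σ
  /-- `Γ ⊢ A = B` -/
  | tyEq {n : ℕ} (Γ : Ctx σ n) (A B : Ty σ n) : Judgment σ
  /-- `Γ ⊢ t : A` -/
  | tm {n : ℕ} (Γ : Ctx σ n) (t : Term σ n) (A : Ty σ n) : Judgment σ
  /-- `Γ ⊢ s = t : A` -/
  | tmEq {n : ℕ} (Γ : Ctx σ n) (s t : Term σ n) (A : Ty σ n) : Judgment σ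

/-- The derivable judgements of a pretheory. A rule or an axiom of the pretheory may be
instantiated only after it has itself been derived to be well formed. Substitution and weakening
are admissible. -/
inductive Derivable (T : PreGAT.{u}) : Judgment T.sig → Prop where
  | ctx_nil (Γ : Ctx T.sig 0) : Derivable T (.ctx Γ)
  | ctx_snoc {n : ℕ} {Γ : Ctx T.sig n} {A : Ty T.sig n} :
      Derivable T (.ctx Γ) → Derivable T (.ty Γ A) → Derivable T (.ctx (Γ.snoc A))
  | var {n : ℕ} {Γ : Ctx T.sig n} (i : Fin n) :
      Derivable T (.ctx Γ) → Derivable T (.tm Γ (.var i) (Γ i))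
  | srt {n : ℕ} {Γ : Ctx T.sig n} (S : T.sig.Srt) (t : Fin (T.sig.srtArity S) → Term T.sig n) :
      Derivable T (.ctx (T.srtCtx S)) → Derivable T (.ctx Γ) →
      (∀ i, Derivable T (.tm Γ (t i) ((T.srtCtx S i).subst t))) →
      Derivable T (.ty Γ ⟨S, t⟩)
  | op {n : ℕ} {Γ : Ctx T.sig n} (f : T.sig.Op) (t : Fin (T.sig.opArity f) → Term T.sig n) :
      Derivable T (.ty (T.opCtx f) (T.opTy f)) → Derivable T (.ctx Γ) →
      (∀ i, Derivable T (.tm Γ (t i) ((T.opCtx f i).subst t))) →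
      Derivable T (.tm Γ (.op f t) ((T.opTy f).subst t))
  | conv {n : ℕ} {Γ : Ctx T.sig n} {t : Term T.sig n} {A B : Ty T.sig n} :
      Derivable T (.tm Γ t A) → Derivable T (.tyEq Γ A B) → Derivable T (.tm Γ t B)
  | tyEq_refl {n : ℕ} {Γ : Ctx T.sig n} {A : Ty T.sig n} :
      Derivable T (.ty Γ A) → Derivable T (.tyEq Γ A A)
  | tyEq_symm {n : ℕ} {Γ : Ctx T.sig n} {A B : Ty T.sig n} :
      Derivable T (.tyEq Γ A B) → Derivable T (.tyEq Γ B A)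
  | tyEq_trans {n : ℕ} {Γ : Ctx T.sig n} {A B C : Ty T.sig n} :
      Derivable T (.tyEq Γ A B) → Derivable T (.tyEq Γ B C) → Derivable T (.tyEq Γ A C)
  | srt_congr {n : ℕ} {Γ : Ctx T.sig n} (S : T.sig.Srt)
      (s t : Fin (T.sig.srtArity S) → Term T.sig n) :
      Derivable T (.ctx (T.srtCtx S)) → Derivable T (.ctx Γ) →
      (∀ i, Derivable T (.tmEq Γ (s i) (t i) ((T.srtCtx S i).subst s))) →
      Derivable T (.tyEq Γ ⟨S, s⟩ ⟨S, t⟩)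
  | tyAx {n : ℕ} {Γ : Ctx T.sig n} (e : TyEqn T.sig) (t : Fin e.n → Term T.sig n) :
      e ∈ T.tyAx → Derivable T (.ty e.ctx e.lhs) → Derivable T (.ty e.ctx e.rhs) →
      Derivable T (.ctx Γ) → (∀ i, Derivable T (.tm Γ (t i) ((e.ctx i).subst t))) →
      Derivable T (.tyEq Γ (e.lhs.subst t) (e.rhs.subst t))
  | tmEq_refl {n : ℕ} {Γ : Ctx T.sig n} {t : Term T.sig n} {A : Ty T.sig n} :
      Derivable T (.tm Γ t A) → Derivable T (.tmEq Γ t t A)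
  | tmEq_symm {n : ℕ} {Γ : Ctx T.sig n} {s t : Term T.sig n} {A : Ty T.sig n} :
      Derivable T (.tmEq Γ s t A) → Derivable T (.tmEq Γ t s A)
  | tmEq_trans {n : ℕ} {Γ : Ctx T.sig n} {r s t : Term T.sig n} {A : Ty T.sig n} :
      Derivable T (.tmEq Γ r s A) → Derivable T (.tmEq Γ s t A) → Derivable T (.tmEq Γ r t A)
  | tmEq_conv {n : ℕ} {Γ : Ctx T.sig n} {s t : Term T.sig n} {A B : Ty T.sig n} :
      Derivable T (.tmEq Γ s t A) → Derivable T (.tyEq Γ A B) → Derivable T (.tmEq Γ s t B)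
  | op_congr {n : ℕ} {Γ : Ctx T.sig n} (f : T.sig.Op)
      (s t : Fin (T.sig.opArity f) → Term T.sig n) :
      Derivable T (.ty (T.opCtx f) (T.opTy f)) → Derivable T (.ctx Γ) →
      (∀ i, Derivable T (.tmEq Γ (s i) (t i) ((T.opCtx f i).subst s))) →
      Derivable T (.tmEq Γ (.op f s) (.op f t) ((T.opTy f).subst s))
  | tmAx {n : ℕ} {Γ : Ctx T.sig n} (e : TmEqn T.sig) (t : Fin e.n → Term T.sig n) :
      e ∈ T.tmAx → Derivable T (.tm e.ctx e.lhs e.ty) → Derivable T (.tm e.ctx e.rhs e.ty) →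
      Derivable T (.ctx Γ) → (∀ i, Derivable T (.tm Γ (t i) ((e.ctx i).subst t))) →
      Derivable T (.tmEq Γ (e.lhs.subst t) (e.rhs.subst t) (e.ty.subst t))

/-- All introductory rules and all axioms are well formed. -/
structure PreGAT.WellFormed (T : PreGAT.{u}) : Prop where
  srt : ∀ S, Derivable T (.ctx (T.srtCtx S))
  op : ∀ f, Derivable T (.ty (T.opCtx f) (T.opTy f))
  tyAx : ∀ e ∈ T.tyAx, Derivable T (.ty e.ctx e.lhs) ∧ Derivable T (.ty e.ctx e.rhs)
  tmAx : ∀ e ∈ T.tmAx, Derivable T (.tm e.ctx e.lhs e.ty) ∧ Derivable T (.tm e.ctx e.rhs e.ty)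

/-- A (finitary) generalised algebraic theory. There may be infinitely many sorts, operators and
axioms, but every context is finite. -/
structure GAT : Type (u + 1) extends PreGAT.{u} where
  wf : toPreGAT.WellFormed

/-! ## Interpretations in sets -/

/-- Families of sets and operations interpreting the symbols of a signature. All the sets
concerned are subsets of one ambient set `V`; the operations are given arbitrary values outside
the interpretation of their context. -/
structure Interp (σ : Signature.{u}) : Type (u + 1) where
  V : Type u
  fam : ∀ S : σ.Srt, (Fin (σ.srtArity S) → V) → Set V
  op : ∀ f : σ.Op, (Fin (σ.opArity f) → V) → V

namespace Interp

variable {σ : Signature.{u}}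

/-- A closed semantic type `S(p)`: a sort symbol with values for its parameters. -/
abbrev Code (M : Interp σ) : Type u := Σ S : σ.Srt, Fin (σ.srtArity S) → M.V

/-- The set denoted by `S(p)`. -/
def El (M : Interp σ) (c : M.Code) : Set M.V := M.fam c.1 c.2

/-- The value of a term. -/
def eval (M : Interp σ) {n : ℕ} (ρ : Fin n → M.V) : Term σ n → M.V
  | .var i => ρ i
  | .op f args => M.op f fun j => M.eval ρ (args j)

/-- The value of a type. -/
def code (M : Interp σ) {n : ℕ} (ρ : Fin n → M.V) (A : Ty σ n) : M.Code :=
  ⟨A.srt, fun j => M.eval ρ (A.args j)⟩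

/-- `ρ` is an element of the interpretation of the context `Γ`. -/
def Sat (M : Interp σ) {n : ℕ} (Γ : Ctx σ n) (ρ : Fin n → M.V) : Prop :=
  ∀ i, ρ i ∈ M.El (M.code ρ (Γ i))

theorem eval_subst (M : Interp σ) {m n : ℕ} (s : Fin m → Term σ n) (ρ : Fin n → M.V)
    (t : Term σ m) : M.eval ρ (t.subst s) = M.eval (fun i => M.eval ρ (s i)) t := by
  induction t with
  | var i => rfl
  | op f args ih => simp only [Term.subst, eval, ih]

theorem code_subst (M : Interp σ) {m n : ℕ} (s : Fin m → Term σ n) (ρ : Fin n → M.V)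
    (A : Ty σ m) : M.code ρ (A.subst s) = M.code (fun i => M.eval ρ (s i)) A := by
  simp only [code, Ty.subst, eval_subst]

theorem code_weaken (M : Interp σ) {n : ℕ} (ρ : Fin (n + 1) → M.V) (A : Ty σ n) :
    M.code ρ A.weaken = M.code (fun i => ρ i.castSucc) A :=
  code_subst M _ ρ A

theorem code_snoc_castSucc (M : Interp σ) {n : ℕ} (ρ : Fin (n + 1) → M.V) (Γ : Ctx σ n)
    (A : Ty σ n) (i : Fin n) :
    M.code ρ (Γ.snoc A i.castSucc) = M.code (fun i => ρ i.castSucc) (Γ i) := by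
  rw [Ctx.snoc, Fin.snoc_castSucc, code_weaken]

theorem code_snoc_last (M : Interp σ) {n : ℕ} (ρ : Fin (n + 1) → M.V) (Γ : Ctx σ n)
    (A : Ty σ n) :
    M.code ρ (Γ.snoc A (Fin.last n)) = M.code (fun i => ρ i.castSucc) A := by
  rw [Ctx.snoc, Fin.snoc_last, code_weaken]

theorem Sat.castSucc {M : Interp σ} {n : ℕ} {Γ : Ctx σ n} {A : Ty σ n} {ρ : Fin (n + 1) → M.V}
    (h : M.Sat (Γ.snoc A) ρ) : M.Sat Γ fun i => ρ i.castSucc := fun i => by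
  have := h i.castSucc
  rwa [code_snoc_castSucc] at this

end Interp

/-! ## Models and homomorphisms -/

/-- A set-valued model: the sort `S` denotes a family of sets indexed by the interpretation of its
context, the operators respect their introductory rules, and the axioms hold. -/
structure Model (T : PreGAT.{u}) : Type (u + 1) extends Interp T.sig where
  sat_of_mem : ∀ (S : T.sig.Srt) (p : Fin (T.sig.srtArity S) → V) (v : V),
    v ∈ fam S p → toInterp.Sat (T.srtCtx S) p
  op_mem : ∀ (f : T.sig.Op) (p : Fin (T.sig.opArity f) → V),
    toInterp.Sat (T.opCtx f) p → op f p ∈ toInterp.El (toInterp.code p (T.opTy f))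
  tyAx : ∀ e ∈ T.tyAx, ∀ ρ, toInterp.Sat e.ctx ρ →
    toInterp.El (toInterp.code ρ e.lhs) = toInterp.El (toInterp.code ρ e.rhs)
  tmAx : ∀ e ∈ T.tmAx, ∀ ρ, toInterp.Sat e.ctx ρ →
    toInterp.eval ρ e.lhs = toInterp.eval ρ e.rhs

/-- The action on elements of contexts of a family of functions between interpretations. -/
def mapEnv {σ : Signature.{u}} {M N : Interp σ} (h : ∀ (c : M.Code) (v : M.V), v ∈ M.El c → N.V)
    {n : ℕ} (Γ : Ctx σ n) (ρ : Fin n → M.V) (hρ : M.Sat Γ ρ) : Fin n → N.V :=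
  fun i => h (M.code ρ (Γ i)) (ρ i) (hρ i)

/-- A homomorphism of models: functions `S(p) → S(h p)` that commute with the operators and agree
on types that an axiom identifies. -/
@[ext]
structure Hom {T : PreGAT.{u}} (M N : Model T) : Type u where
  toFun : ∀ (c : M.Code) (v : M.V), v ∈ M.El c → N.V
  map_mem : ∀ (c : M.Code) (v : M.V) (hv : v ∈ M.El c),
    toFun c v hv ∈
      N.fam c.1 (mapEnv (N := N.toInterp) toFun (T.srtCtx c.1) c.2 (M.sat_of_mem c.1 c.2 v hv))
  map_op : ∀ (f : T.sig.Op) (p : Fin (T.sig.opArity f) → M.V) (hp : M.Sat (T.opCtx f) p),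
    toFun (M.code p (T.opTy f)) (M.op f p) (M.op_mem f p hp) =
      N.op f (mapEnv (N := N.toInterp) toFun (T.opCtx f) p hp)
  map_tyAx : ∀ e ∈ T.tyAx, ∀ ρ, M.Sat e.ctx ρ →
    ∀ (v : M.V) (hl : v ∈ M.El (M.code ρ e.lhs)) (hr : v ∈ M.El (M.code ρ e.rhs)),
      toFun (M.code ρ e.lhs) v hl = toFun (M.code ρ e.rhs) v hr

/-! ## Soundness (needed to compose homomorphisms) -/

/-- The meaning of a judgement in an interpretation. -/
def Interp.Valid {σ : Signature.{u}} (M : Interp σ) : Judgment σ → Prop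
  | .ctx _ => True
  | .ty _ _ => True
  | .tyEq Γ A B => ∀ ρ, M.Sat Γ ρ → M.El (M.code ρ A) = M.El (M.code ρ B)
  | .tm Γ t A => ∀ ρ, M.Sat Γ ρ → M.eval ρ t ∈ M.El (M.code ρ A)
  | .tmEq Γ s t _ => ∀ ρ, M.Sat Γ ρ → M.eval ρ s = M.eval ρ t

theorem Interp.sat_subst {σ : Signature.{u}} {M : Interp σ} {m n : ℕ} {Γ : Ctx σ n} {Δ : Ctx σ m}
    {t : Fin m → Term σ n} (h : ∀ i, M.Valid (.tm Γ (t i) ((Δ i).subst t)))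
    {ρ : Fin n → M.V} (hρ : M.Sat Γ ρ) : M.Sat Δ fun i => M.eval ρ (t i) := fun i => by
  have := h i ρ hρ
  rwa [code_subst] at this

theorem Model.sound {T : PreGAT.{u}} (M : Model T) {J : Judgment T.sig} (hJ : Derivable T J) :
    M.Valid J := by
  induction hJ with
  | ctx_nil Γ => trivial
  | ctx_snoc _ _ _ _ => trivial
  | var i _ _ => exact fun ρ hρ => hρ i
  | srt S t _ _ _ _ _ _ => trivial
  | op f t _ _ _ _ _ ih =>
    intro ρ hρ
    rw [Interp.code_subst]
    exact M.op_mem f _ (Interp.sat_subst ih hρ)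
  | conv _ _ ih₁ ih₂ => exact fun ρ hρ => ih₂ ρ hρ ▸ ih₁ ρ hρ
  | tyEq_refl _ _ => exact fun _ _ => rfl
  | tyEq_symm _ ih => exact fun ρ hρ => (ih ρ hρ).symm
  | tyEq_trans _ _ ih₁ ih₂ => exact fun ρ hρ => (ih₁ ρ hρ).trans (ih₂ ρ hρ)
  | srt_congr S s t _ _ _ _ _ ih =>
    intro ρ hρ
    simp only [Interp.code, fun i => ih i ρ hρ]
  | tyAx e t he _ _ _ _ _ _ _ ih =>
    intro ρ hρ
    rw [Interp.code_subst, Interp.code_subst]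
    exact M.tyAx e he _ (Interp.sat_subst ih hρ)
  | tmEq_refl _ _ => exact fun _ _ => rfl
  | tmEq_symm _ ih => exact fun ρ hρ => (ih ρ hρ).symm
  | tmEq_trans _ _ ih₁ ih₂ => exact fun ρ hρ => (ih₁ ρ hρ).trans (ih₂ ρ hρ)
  | tmEq_conv _ _ ih _ => exact ih
  | op_congr f s t _ _ _ _ _ ih =>
    intro ρ hρ
    simp only [Interp.eval, fun i => ih i ρ hρ]
  | tmAx e t he _ _ _ _ _ _ _ ih =>
    intro ρ hρ
    rw [Interp.eval_subst, Interp.eval_subst]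
    exact M.tmAx e he _ (Interp.sat_subst ih hρ)

namespace Hom

variable {T : PreGAT.{u}} {M N : Model T}

theorem toFun_congr (h : Hom M N) {c d : M.Code} {v w : M.V} (hc : c = d) (hvw : v = w)
    (hv : v ∈ M.El c) (hw : w ∈ M.El d) : h.toFun c v hv = h.toFun d w hw := by
  subst hc hvw; rfl

/-- `h` acting on elements of contexts. -/
abbrev env (h : Hom M N) {n : ℕ} (Γ : Ctx T.sig n) (ρ : Fin n → M.V) (hρ : M.Sat Γ ρ) :
    Fin n → N.V :=
  mapEnv (N := N.toInterp) h.toFun Γ ρ hρ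

theorem env_congr (h : Hom M N) {n : ℕ} (Γ : Ctx T.sig n) {ρ ρ' : Fin n → M.V} (e : ρ = ρ')
    (hρ : M.Sat Γ ρ) (hρ' : M.Sat Γ ρ') : h.env Γ ρ hρ = h.env Γ ρ' hρ' := by
  subst e; rfl

/-- The image under `h` of a semantic type that has an element. -/
def mapCode (h : Hom M N) (c : M.Code) (v : M.V) (hv : v ∈ M.El c) : N.Code :=
  ⟨c.1, h.env (T.srtCtx c.1) c.2 (M.sat_of_mem c.1 c.2 v hv)⟩

theorem mapCode_congr (h : Hom M N) {c d : M.Code} {v w : M.V} (hc : c = d)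
    (hv : v ∈ M.El c) (hw : w ∈ M.El d) : h.mapCode c v hv = h.mapCode d w hw := by
  subst hc; rfl

theorem mem_mapCode (h : Hom M N) (c : M.Code) (v : M.V) (hv : v ∈ M.El c) :
    h.toFun c v hv ∈ N.El (h.mapCode c v hv) :=
  h.map_mem c v hv

/-- What a judgement says about a homomorphism. -/
def Valid (h : Hom M N) : Judgment T.sig → Prop
  | .ctx Γ => ∀ ρ (hρ : M.Sat Γ ρ) i,
      h.mapCode (M.code ρ (Γ i)) (ρ i) (hρ i) = N.code (h.env Γ ρ hρ) (Γ i)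
  | .ty Γ A => ∀ ρ (hρ : M.Sat Γ ρ) v (hv : v ∈ M.El (M.code ρ A)),
      h.mapCode (M.code ρ A) v hv = N.code (h.env Γ ρ hρ) A
  | .tyEq Γ A B => ∀ ρ, M.Sat Γ ρ →
      ∀ v (hl : v ∈ M.El (M.code ρ A)) (hr : v ∈ M.El (M.code ρ B)),
        h.toFun (M.code ρ A) v hl = h.toFun (M.code ρ B) v hr
  | .tm Γ t A => ∀ ρ (hρ : M.Sat Γ ρ) (hv : M.eval ρ t ∈ M.El (M.code ρ A)),
      h.toFun (M.code ρ A) (M.eval ρ t) hv = N.eval (h.env Γ ρ hρ) t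
  | .tmEq _ _ _ _ => True

theorem env_subst (h : Hom M N) {m n : ℕ} {Γ : Ctx T.sig n} {Δ : Ctx T.sig m}
    {t : Fin m → Term T.sig n} (hM : ∀ i, M.Valid (.tm Γ (t i) ((Δ i).subst t)))
    (hh : ∀ i, h.Valid (.tm Γ (t i) ((Δ i).subst t))) {ρ : Fin n → M.V} (hρ : M.Sat Γ ρ)
    (hΔ : M.Sat Δ fun i => M.eval ρ (t i)) :
    h.env Δ (fun i => M.eval ρ (t i)) hΔ = fun i => N.eval (h.env Γ ρ hρ) (t i) := by
  funext i
  rw [← hh i ρ hρ (hM i ρ hρ)]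
  exact h.toFun_congr (M.code_subst t ρ (Δ i)).symm rfl _ _

theorem env_castSucc (h : Hom M N) {n : ℕ} {Γ : Ctx T.sig n} {A : Ty T.sig n}
    {ρ : Fin (n + 1) → M.V} (hρ : M.Sat (Γ.snoc A) ρ) :
    (fun i => h.env (Γ.snoc A) ρ hρ (Fin.castSucc i)) =
      h.env Γ (fun i => ρ i.castSucc) hρ.castSucc := by
  funext i
  exact h.toFun_congr (M.code_snoc_castSucc ρ Γ A i) rfl _ _

theorem sound (h : Hom M N) {J : Judgment T.sig} (hJ : Derivable T J) : h.Valid J := by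
  induction hJ with
  | ctx_nil Γ => exact fun _ _ i => i.elim0
  | @ctx_snoc n Γ A _ _ ih₁ ih₂ =>
    intro ρ hρ i
    induction i using Fin.lastCases with
    | last =>
      have hl := hρ (Fin.last n)
      rw [Interp.code_snoc_last] at hl
      refine (h.mapCode_congr (v := ρ (Fin.last n)) (w := ρ (Fin.last n))
        (M.code_snoc_last ρ Γ A) _ hl).trans ?_
      rw [N.code_snoc_last, env_castSucc]
      exact ih₂ _ hρ.castSucc _ hl
    | cast i =>
      refine (h.mapCode_congr (v := ρ i.castSucc) (w := ρ i.castSucc)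
        (M.code_snoc_castSucc ρ Γ A i) _ (hρ.castSucc i)).trans ?_
      rw [N.code_snoc_castSucc, env_castSucc]
      exact ih₁ _ hρ.castSucc i
  | var i _ _ => exact fun _ _ _ => rfl
  | srt S t _ _ ht _ _ ih =>
    intro ρ hρ v hv
    refine congrArg (Sigma.mk S) ?_
    exact h.env_subst (fun i => M.sound (ht i)) ih hρ _
  | op f t _ _ ht _ _ ih =>
    intro ρ hρ hv
    have hs := Interp.sat_subst (fun i => M.sound (ht i)) hρ
    have he := h.env_subst (fun i => M.sound (ht i)) ih hρ hs
    refine Eq.trans ?_ ((h.map_op f _ hs).trans (congrArg (N.op f) he))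
    exact h.toFun_congr (M.code_subst t ρ _) rfl _ _
  | conv h₁ h₂ ih₁ ih₂ =>
    intro ρ hρ hv
    have hA := M.sound h₁ ρ hρ
    rw [← ih₁ ρ hρ hA]
    exact (ih₂ ρ hρ _ hA hv).symm
  | tyEq_refl _ _ => exact fun _ _ _ _ _ => rfl
  | tyEq_symm _ ih => exact fun ρ hρ v hl hr => (ih ρ hρ v hr hl).symm
  | tyEq_trans h₁ _ ih₁ ih₂ =>
    intro ρ hρ v hl hr
    have hm := (M.sound h₁ ρ hρ) ▸ hl
    exact (ih₁ ρ hρ v hl hm).trans (ih₂ ρ hρ v hm hr)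
  | srt_congr S s t _ _ hst _ _ _ =>
    intro ρ hρ v hl hr
    exact h.toFun_congr (congrArg (Sigma.mk S) (funext fun i => M.sound (hst i) ρ hρ)) rfl _ _
  | tyAx e t he _ _ _ ht _ _ _ _ =>
    intro ρ hρ v hl hr
    have hs := Interp.sat_subst (fun i => M.sound (ht i)) hρ
    have hl' := hl
    have hr' := hr
    rw [Interp.code_subst] at hl' hr'
    exact (h.toFun_congr (M.code_subst t ρ _) rfl _ hl').trans
      ((h.map_tyAx e he _ hs v hl' hr').trans
        (h.toFun_congr (M.code_subst t ρ _).symm rfl hr' _))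
  | tmEq_refl _ _ => trivial
  | tmEq_symm _ _ => trivial
  | tmEq_trans _ _ _ _ => trivial
  | tmEq_conv _ _ _ _ => trivial
  | op_congr _ _ _ _ _ _ _ _ _ => trivial
  | tmAx _ _ _ _ _ _ _ _ _ _ _ => trivial

theorem mapCode_eq (h : Hom M N) {n : ℕ} {Γ : Ctx T.sig n} (hΓ : Derivable T (.ctx Γ))
    {ρ : Fin n → M.V} (hρ : M.Sat Γ ρ) (i : Fin n) :
    h.mapCode (M.code ρ (Γ i)) (ρ i) (hρ i) = N.code (h.env Γ ρ hρ) (Γ i) :=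
  h.sound hΓ ρ hρ i

theorem sat_env (h : Hom M N) {n : ℕ} {Γ : Ctx T.sig n} (hΓ : Derivable T (.ctx Γ))
    {ρ : Fin n → M.V} (hρ : M.Sat Γ ρ) : N.Sat Γ (h.env Γ ρ hρ) := fun i => by
  rw [← h.mapCode_eq hΓ hρ i]
  exact h.mem_mapCode _ _ _

end Hom

/-- Derivable types, terms and equations live in derivable contexts. -/
theorem Derivable.ctx_of_ty {T : PreGAT.{u}} {n : ℕ} {Γ : Ctx T.sig n} {A : Ty T.sig n}
    (h : Derivable T (.ty Γ A)) : Derivable T (.ctx Γ) := by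
  cases h with
  | srt S t _ hΓ _ => exact hΓ

/-! ## The category of models -/

/-- The objects of the category of models of a generalised algebraic theory. -/
structure GAT.Alg (T : GAT.{u}) : Type (u + 1) where
  model : Model T.toPreGAT

namespace Hom

variable {T : PreGAT.{u}}

/-- The identity homomorphism. -/
def id (M : Model T) : Hom M M where
  toFun _ v _ := v
  map_mem _ _ hv := hv
  map_op _ _ _ := rfl
  map_tyAx _ _ _ _ _ _ _ := rfl

/-- The composite on underlying elements. -/
def compFun {L M N : Model T} (h : Hom L M) (k : Hom M N) (c : L.Code) (v : L.V)
    (hv : v ∈ L.El c) : N.V :=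
  k.toFun (h.mapCode c v hv) (h.toFun c v hv) (h.mem_mapCode c v hv)

theorem mapEnv_compFun {L M N : Model T} (h : Hom L M) (k : Hom M N) {n : ℕ} {Γ : Ctx T.sig n}
    (hΓ : Derivable T (.ctx Γ)) {ρ : Fin n → L.V} (hρ : L.Sat Γ ρ) :
    mapEnv (N := N.toInterp) (h.compFun k) Γ ρ hρ = k.env Γ (h.env Γ ρ hρ) (h.sat_env hΓ hρ) := by
  funext i
  exact k.toFun_congr (h.mapCode_eq hΓ hρ i) rfl _ _

/-- Composition of homomorphisms. -/
def comp (hT : T.WellFormed) {L M N : Model T} (h : Hom L M) (k : Hom M N) : Hom L N where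
  toFun := h.compFun k
  map_mem c v hv := by
    rw [mapEnv_compFun h k (hT.srt c.1)]
    exact k.map_mem _ _ (h.mem_mapCode c v hv)
  map_op f p hp := by
    have hc := (hT.op f).ctx_of_ty
    have hs := h.sat_env hc hp
    rw [mapEnv_compFun h k hc, ← k.map_op f _ hs]
    exact k.toFun_congr (h.sound (hT.op f) p hp _ _) (h.map_op f p hp) _ _
  map_tyAx e he ρ hρ v hl hr := by
    have hw := hT.tyAx e he
    have hs := h.sat_env hw.1.ctx_of_ty hρ
    have el := h.sound hw.1 ρ hρ v hl
    have er := h.sound hw.2 ρ hρ v hr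
    have ev := h.map_tyAx e he ρ hρ v hl hr
    have ml := h.mem_mapCode _ v hl
    have mr := h.mem_mapCode _ v hr
    have ml' := ml
    have mr' := mr
    rw [el] at ml'
    rw [er, ← ev] at mr'
    exact (k.toFun_congr el rfl ml ml').trans
      ((k.map_tyAx e he _ hs _ ml' mr').trans (k.toFun_congr er.symm ev mr' mr))

theorem comp_assoc (hT : T.WellFormed) {K L M N : Model T} (h : Hom K L) (k : Hom L M)
    (l : Hom M N) : (h.comp hT k).comp hT l = h.comp hT (k.comp hT l) := by
  ext c v hv
  exact l.toFun_congr (congrArg (Sigma.mk c.1)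
    (mapEnv_compFun h k (hT.srt c.1) (K.sat_of_mem c.1 c.2 v hv))) rfl _ _

end Hom

instance (T : GAT.{u}) : Category.{u} T.Alg where
  Hom M N := Hom M.model N.model
  id M := Hom.id M.model
  comp h k := h.comp T.wf k
  id_comp _ := rfl
  comp_id _ := rfl
  assoc h k l := Hom.comp_assoc T.wf h k l

/-! ## Extensions by operators and equations -/

/-- Add operator symbols to a signature, keeping the sort symbols. -/
abbrev Signature.addOps (σ : Signature.{u}) (Op : Type u) (ar : Op → ℕ) : Signature.{u} where
  Srt := σ.Srt
  Op := σ.Op ⊕ Op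
  srtArity := σ.srtArity
  opArity := Sum.elim σ.opArity ar

section lift

variable {σ : Signature.{u}} (Op : Type u) (ar : Op → ℕ)

/-- A term, seen as a term over a signature with more operators. -/
def Term.lift {n : ℕ} : Term σ n → Term (σ.addOps Op ar) n
  | .var i => .var i
  | .op f args => .op (σ := σ.addOps Op ar) (Sum.inl f) fun j => (args j).lift

/-- A type, seen as a type over a signature with more operators. -/
def Ty.lift {n : ℕ} (A : Ty σ n) : Ty (σ.addOps Op ar) n where
  srt := A.srt
  args j := (A.args j).lift Op ar

/-- A context, seen as a context over a signature with more operators. -/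
def Ctx.lift {n : ℕ} (Γ : Ctx σ n) : Ctx (σ.addOps Op ar) n := fun i => (Γ i).lift Op ar

/-- A type equation, seen over a signature with more operators. -/
def TyEqn.lift (e : TyEqn σ) : TyEqn (σ.addOps Op ar) where
  n := e.n
  ctx := e.ctx.lift Op ar
  lhs := e.lhs.lift Op ar
  rhs := e.rhs.lift Op ar

/-- A term equation, seen over a signature with more operators. -/
def TmEqn.lift (e : TmEqn σ) : TmEqn (σ.addOps Op ar) where
  n := e.n
  ctx := e.ctx.lift Op ar
  ty := e.ty.lift Op ar
  lhs := e.lhs.lift Op ar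
  rhs := e.rhs.lift Op ar

end lift

/-- Raw data extending a theory by new operators and new equations, but no new sorts. -/
structure PreExtension (T : PreGAT.{u}) : Type (u + 1) where
  Op : Type u
  opArity : Op → ℕ
  opCtx : ∀ f : Op, Ctx (T.sig.addOps Op opArity) (opArity f)
  opTy : ∀ f : Op, Ty (T.sig.addOps Op opArity) (opArity f)
  tyAx : Set (TyEqn (T.sig.addOps Op opArity))
  tmAx : Set (TmEqn (T.sig.addOps Op opArity))

/-- The extended pretheory. -/
def PreExtension.total {T : PreGAT.{u}} (E : PreExtension T) : PreGAT.{u} where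
  sig := T.sig.addOps E.Op E.opArity
  srtCtx S := (T.srtCtx S).lift E.Op E.opArity
  opCtx
    | .inl f => (T.opCtx f).lift E.Op E.opArity
    | .inr f => E.opCtx f
  opTy
    | .inl f => (T.opTy f).lift E.Op E.opArity
    | .inr f => E.opTy f
  tyAx := TyEqn.lift E.Op E.opArity '' T.tyAx ∪ E.tyAx
  tmAx := TmEqn.lift E.Op E.opArity '' T.tmAx ∪ E.tmAx

/-- An extension `T ⊂ T'` of generalised algebraic theories that adds operators and equations,
but no new sorts. -/
structure Extension (T : GAT.{u}) : Type (u + 1) extends PreExtension T.toPreGAT where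
  wf : toPreExtension.total.WellFormed

/-- The extended theory `T'`. -/
def Extension.theory {T : GAT.{u}} (E : Extension T) : GAT.{u} where
  toPreGAT := E.toPreExtension.total
  wf := E.wf

/-! ## The forgetful functor -/

/-- Forget the new operators. -/
def Interp.forget {σ : Signature.{u}} {Op : Type u} {ar : Op → ℕ} (M : Interp (σ.addOps Op ar)) :
    Interp σ where
  V := M.V
  fam := M.fam
  op f := M.op (Sum.inl f)

theorem Interp.eval_lift {σ : Signature.{u}} {Op : Type u} {ar : Op → ℕ}
    (M : Interp (σ.addOps Op ar)) {n : ℕ} (ρ : Fin n → M.V) (t : Term σ n) :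
    M.eval ρ (t.lift Op ar) = M.forget.eval ρ t := by
  induction t with
  | var i => rfl
  | op f args ih =>
    exact congrArg (M.op (Sum.inl f)) (funext ih)

theorem Interp.code_lift {σ : Signature.{u}} {Op : Type u} {ar : Op → ℕ}
    (M : Interp (σ.addOps Op ar)) {n : ℕ} (ρ : Fin n → M.V) (A : Ty σ n) :
    M.code ρ (A.lift Op ar) = M.forget.code ρ A :=
  congrArg (Sigma.mk A.srt) (funext fun j => M.eval_lift ρ (A.args j))

theorem Interp.sat_lift {σ : Signature.{u}} {Op : Type u} {ar : Op → ℕ}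
    (M : Interp (σ.addOps Op ar)) {n : ℕ} (ρ : Fin n → M.V) (Γ : Ctx σ n) :
    M.Sat (Γ.lift Op ar) ρ ↔ M.forget.Sat Γ ρ :=
  forall_congr' fun i => by
    rw [Ctx.lift, Interp.code_lift]; rfl

/-- The underlying model of the smaller theory. -/
def Model.forget {T : PreGAT.{u}} {E : PreExtension T} (M : Model E.total) : Model T where
  toInterp := Interp.forget (Op := E.Op) (ar := E.opArity) M.toInterp
  sat_of_mem S p v hv := (Interp.sat_lift _ _ _).1 (M.sat_of_mem S p v hv)
  op_mem f p hp := by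
    have h := M.op_mem (Sum.inl f) p ((Interp.sat_lift _ _ _).2 hp)
    have hc := Interp.code_lift (Op := E.Op) (ar := E.opArity) M.toInterp p (T.opTy f)
    exact (congrArg M.El hc) ▸ h
  tyAx e he ρ hρ := by
    have h := M.tyAx (e.lift E.Op E.opArity) (Or.inl ⟨e, he, rfl⟩) ρ ((Interp.sat_lift _ _ _).2 hρ)
    have hl := Interp.code_lift (Op := E.Op) (ar := E.opArity) M.toInterp ρ e.lhs
    have hr := Interp.code_lift (Op := E.Op) (ar := E.opArity) M.toInterp ρ e.rhs
    exact (congrArg M.El hl).symm.trans (h.trans (congrArg M.El hr))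
  tmAx e he ρ hρ := by
    have h := M.tmAx (e.lift E.Op E.opArity) (Or.inl ⟨e, he, rfl⟩) ρ ((Interp.sat_lift _ _ _).2 hρ)
    have hl := Interp.eval_lift (Op := E.Op) (ar := E.opArity) M.toInterp ρ e.lhs
    have hr := Interp.eval_lift (Op := E.Op) (ar := E.opArity) M.toInterp ρ e.rhs
    exact hl.symm.trans (h.trans hr)

theorem mapEnv_forget {T : PreGAT.{u}} {E : PreExtension T} {M N : Model E.total} (h : Hom M N)
    {n : ℕ} (Γ : Ctx T.sig n) (ρ : Fin n → M.V) (hρ : M.Sat (Γ.lift E.Op E.opArity) ρ)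
    (hρ' : M.forget.Sat Γ ρ) :
    mapEnv (N := N.toInterp) h.toFun (Γ.lift E.Op E.opArity) ρ hρ =
      mapEnv (M := M.forget.toInterp) (N := N.forget.toInterp) h.toFun Γ ρ hρ' := by
  funext i
  exact h.toFun_congr
    (Interp.code_lift (Op := E.Op) (ar := E.opArity) M.toInterp ρ (Γ i)) rfl _ _

/-- The underlying homomorphism of models of the smaller theory. -/
def Hom.forget {T : PreGAT.{u}} {E : PreExtension T} {M N : Model E.total} (h : Hom M N) :
    Hom M.forget N.forget where
  toFun := h.toFun
  map_mem c v hv := by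
    rw [← mapEnv_forget h (T.srtCtx c.1) c.2 (M.sat_of_mem c.1 c.2 v hv)]
    exact h.map_mem c v hv
  map_op f p hp := by
    have hp' : M.Sat ((T.opCtx f).lift E.Op E.opArity) p := (Interp.sat_lift _ _ _).2 hp
    rw [← mapEnv_forget h (T.opCtx f) p hp']
    refine Eq.trans ?_ (h.map_op (Sum.inl f) p hp')
    exact h.toFun_congr
      (Interp.code_lift (Op := E.Op) (ar := E.opArity) M.toInterp p (T.opTy f)).symm rfl _ _
  map_tyAx e he ρ hρ v hl hr := by
    have el := Interp.code_lift (Op := E.Op) (ar := E.opArity) M.toInterp ρ e.lhs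
    have er := Interp.code_lift (Op := E.Op) (ar := E.opArity) M.toInterp ρ e.rhs
    have hl' := (congrArg M.El el).symm ▸ hl
    have hr' := (congrArg M.El er).symm ▸ hr
    exact (h.toFun_congr el.symm rfl hl hl').trans
      ((h.map_tyAx (e.lift E.Op E.opArity) (Or.inl ⟨e, he, rfl⟩) ρ
        ((Interp.sat_lift _ _ _).2 hρ) v hl' hr').trans (h.toFun_congr er rfl hr' hr))

/-- The forgetful functor `Alg_{T'} ⥤ Alg_T` of an extension `T ⊂ T'`. -/
def Extension.forget {T : GAT.{u}} (E : Extension T) : E.theory.Alg ⥤ T.Alg where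
  obj M := ⟨M.model.forget⟩
  map {M N} h := Hom.forget (M := M.model) (N := N.model) h
  map_id _ := rfl
  map_comp {L M _} h k := by
    refine Hom.ext (funext fun c => funext fun v => funext fun hv => ?_)
    have hv' : v ∈ L.model.El c := hv
    exact Hom.toFun_congr (M := M.model) k (congrArg (Sigma.mk c.1)
      (mapEnv_forget (M := L.model) (N := M.model) h (T.srtCtx c.1) c.2
        (L.model.sat_of_mem c.1 c.2 v hv') _)) rfl _ _

end GATheory

/-! A left adjoint preserves all colimits, which settles one direction. For the converse, `U`
preserves filtered colimits for every such extension. Contexts are finite, so filtered colimits of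
models are computed on elements of sorts, and both theories have the same sorts. Hence a `U` that
preserves finite colimits also preserves the filtered colimits needed for an adjoint functor
theorem.

That theorem (`isLeftAdjoint_of_isStrongGenerator`) needs `Alg_{T'}` to be cocomplete with a small
strong generator of finitely presentable objects. The closure `R` of the generator under finite
colimits is then dense. For an object `Z` of the target, the pairs of `r` in `R` and a map `U r ⟶ Z`
form a filtered category. The colimit of the objects `r` is the value of the right adjoint at `Z`
(`isLeftAdjoint_of_isDense`).

Limits of models are constructed by hand. Weakly initial models made of raw terms give solution
sets, so the general adjoint functor theorem yields colimits and a left adjoint of each functor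
`elts T S`. The values of these left adjoints at a point are the generators. They are finitely
presentable because `elts T S` preserves filtered colimits, and they form a strong generator because
homomorphisms are determined, and isomorphisms detected, on elements.

The delicate point is the construction of filtered colimits. The action of a homomorphism on an
element depends on the semantic type in which the element is taken, so the construction works with
pairs `Interp.Pt` of a type and an element. It identifies values by `Indist`, a relation stable
under homomorphisms. -/

namespace GATheory

open CategoryTheory Limits

/-! ## Maps from a model to an interpretation -/

/-- An element of an interpretation together with a semantic type to which it belongs. -/
@[ext]
structure Interp.Pt {σ : Signature.{u}} (M : Interp σ) : Type u where
  code : M.Code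
  val : M.V
  mem : val ∈ M.El code

/-- The data of a homomorphism whose target is an interpretation, not necessarily a model. -/
structure PreHom {T : PreGAT.{u}} (M : Model T) (N : Interp T.sig) : Type u where
  toFun : ∀ (c : M.Code) (v : M.V), v ∈ M.El c → N.V
  map_mem : ∀ (c : M.Code) (v : M.V) (hv : v ∈ M.El c),
    toFun c v hv ∈ N.fam c.1 (mapEnv (N := N) toFun (T.srtCtx c.1) c.2 (M.sat_of_mem c.1 c.2 v hv))
  map_op : ∀ (f : T.sig.Op) (p : Fin (T.sig.opArity f) → M.V) (hp : M.Sat (T.opCtx f) p),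
    toFun (M.code p (T.opTy f)) (M.op f p) (M.op_mem f p hp) =
      N.op f (mapEnv (N := N) toFun (T.opCtx f) p hp)
  map_tyAx : ∀ e ∈ T.tyAx, ∀ ρ, M.Sat e.ctx ρ →
    ∀ (v : M.V) (hl : v ∈ M.El (M.code ρ e.lhs)) (hr : v ∈ M.El (M.code ρ e.rhs)),
      toFun (M.code ρ e.lhs) v hl = toFun (M.code ρ e.rhs) v hr

/-- A homomorphism, seen as a map to the underlying interpretation. -/
@[simps toFun]
def Hom.toPreHom {T : PreGAT.{u}} {M N : Model T} (h : Hom M N) : PreHom M N.toInterp :=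
  ⟨h.toFun, h.map_mem, h.map_op, h.map_tyAx⟩

namespace PreHom

variable {T : PreGAT.{u}} {M : Model T} {N : Interp T.sig}

theorem toFun_congr (h : PreHom M N) {c d : M.Code} {v w : M.V} (hc : c = d) (hvw : v = w)
    (hv : v ∈ M.El c) (hw : w ∈ M.El d) : h.toFun c v hv = h.toFun d w hw := by
  subst hc hvw; rfl

/-- The action on elements of contexts. -/
abbrev env (h : PreHom M N) {n : ℕ} (Γ : Ctx T.sig n) (ρ : Fin n → M.V) (hρ : M.Sat Γ ρ) :
    Fin n → N.V :=
  mapEnv (N := N) h.toFun Γ ρ hρ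

/-- The action on elements of semantic types. -/
def mapPt (h : PreHom M N) (x : M.Pt) : N.Pt where
  code := ⟨x.code.1, h.env (T.srtCtx x.code.1) x.code.2 (M.sat_of_mem _ _ _ x.mem)⟩
  val := h.toFun x.code x.val x.mem
  mem := h.map_mem _ _ _

/-- The element serves only to witness that the parameters satisfy their context, so the image of
the semantic type does not depend on it. -/
theorem mapPt_code_congr (h : PreHom M N) {x y : M.Pt} (hxy : x.code = y.code) :
    (h.mapPt x).code = (h.mapPt y).code := by
  obtain ⟨c, v, hv⟩ := x
  obtain ⟨d, w, hw⟩ := y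
  obtain rfl : c = d := hxy
  rfl

/-- What a judgement says about a map from a model to an interpretation. -/
def Valid (h : PreHom M N) : Judgment T.sig → Prop
  | .ctx Γ => ∀ ρ (hρ : M.Sat Γ ρ) i,
      (h.mapPt ⟨M.code ρ (Γ i), ρ i, hρ i⟩).code = N.code (h.env Γ ρ hρ) (Γ i)
  | .ty Γ A => ∀ ρ (hρ : M.Sat Γ ρ) v (hv : v ∈ M.El (M.code ρ A)),
      (h.mapPt ⟨M.code ρ A, v, hv⟩).code = N.code (h.env Γ ρ hρ) A
  | .tyEq Γ A B => ∀ ρ, M.Sat Γ ρ →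
      ∀ v (hl : v ∈ M.El (M.code ρ A)) (hr : v ∈ M.El (M.code ρ B)),
        h.toFun (M.code ρ A) v hl = h.toFun (M.code ρ B) v hr
  | .tm Γ t A => ∀ ρ (hρ : M.Sat Γ ρ) (hv : M.eval ρ t ∈ M.El (M.code ρ A)),
      h.toFun (M.code ρ A) (M.eval ρ t) hv = N.eval (h.env Γ ρ hρ) t
  | .tmEq _ _ _ _ => True

theorem env_subst (h : PreHom M N) {m n : ℕ} {Γ : Ctx T.sig n} {Δ : Ctx T.sig m}
    {t : Fin m → Term T.sig n} (hM : ∀ i, M.Valid (.tm Γ (t i) ((Δ i).subst t)))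
    (hh : ∀ i, h.Valid (.tm Γ (t i) ((Δ i).subst t))) {ρ : Fin n → M.V} (hρ : M.Sat Γ ρ)
    (hΔ : M.Sat Δ fun i => M.eval ρ (t i)) :
    h.env Δ (fun i => M.eval ρ (t i)) hΔ = fun i => N.eval (h.env Γ ρ hρ) (t i) := by
  funext i
  rw [← hh i ρ hρ (hM i ρ hρ)]
  exact h.toFun_congr (M.code_subst t ρ (Δ i)).symm rfl _ _

theorem env_castSucc (h : PreHom M N) {n : ℕ} {Γ : Ctx T.sig n} {A : Ty T.sig n}
    {ρ : Fin (n + 1) → M.V} (hρ : M.Sat (Γ.snoc A) ρ) :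
    (fun i => h.env (Γ.snoc A) ρ hρ (Fin.castSucc i)) =
      h.env Γ (fun i => ρ i.castSucc) hρ.castSucc := by
  funext i
  exact h.toFun_congr (M.code_snoc_castSucc ρ Γ A i) rfl _ _

/-- The induction for `Hom.sound` uses only that the source is a model. Dropping the laws of the
target allows the lemma to be used for a filtered colimit before that is known to be a model. -/
theorem sound (h : PreHom M N) {J : Judgment T.sig} (hJ : Derivable T J) : h.Valid J := by
  induction hJ with
  | ctx_nil Γ => exact fun _ _ i => i.elim0
  | @ctx_snoc n Γ A _ _ ih₁ ih₂ =>
    intro ρ hρ i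
    induction i using Fin.lastCases with
    | last =>
      have hl := hρ (Fin.last n)
      rw [Interp.code_snoc_last] at hl
      refine (h.mapPt_code_congr (y := ⟨_, ρ (Fin.last n), hl⟩)
        (M.code_snoc_last ρ Γ A)).trans ?_
      rw [N.code_snoc_last, env_castSucc]
      exact ih₂ _ hρ.castSucc _ hl
    | cast i =>
      refine (h.mapPt_code_congr (y := ⟨_, ρ i.castSucc, hρ.castSucc i⟩)
        (M.code_snoc_castSucc ρ Γ A i)).trans ?_
      rw [N.code_snoc_castSucc, env_castSucc]
      exact ih₁ _ hρ.castSucc i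
  | var i _ _ => exact fun _ _ _ => rfl
  | srt S t _ _ ht _ _ ih =>
    intro ρ hρ v hv
    exact congrArg (Sigma.mk S) (h.env_subst (fun i => M.sound (ht i)) ih hρ _)
  | op f t _ _ ht _ _ ih =>
    intro ρ hρ hv
    have hs := Interp.sat_subst (fun i => M.sound (ht i)) hρ
    have he := h.env_subst (fun i => M.sound (ht i)) ih hρ hs
    refine Eq.trans ?_ ((h.map_op f _ hs).trans (congrArg (N.op f) he))
    exact h.toFun_congr (M.code_subst t ρ _) rfl _ _
  | conv h₁ h₂ ih₁ ih₂ =>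
    intro ρ hρ hv
    have hA := M.sound h₁ ρ hρ
    rw [← ih₁ ρ hρ hA]
    exact (ih₂ ρ hρ _ hA hv).symm
  | tyEq_refl _ _ => exact fun _ _ _ _ _ => rfl
  | tyEq_symm _ ih => exact fun ρ hρ v hl hr => (ih ρ hρ v hr hl).symm
  | tyEq_trans h₁ _ ih₁ ih₂ =>
    intro ρ hρ v hl hr
    have hm := (M.sound h₁ ρ hρ) ▸ hl
    exact (ih₁ ρ hρ v hl hm).trans (ih₂ ρ hρ v hm hr)
  | srt_congr S s t _ _ hst _ _ _ =>
    intro ρ hρ v hl hr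
    exact h.toFun_congr (congrArg (Sigma.mk S) (funext fun i => M.sound (hst i) ρ hρ)) rfl _ _
  | tyAx e t he _ _ _ ht _ _ _ _ =>
    intro ρ hρ v hl hr
    have hs := Interp.sat_subst (fun i => M.sound (ht i)) hρ
    have hl' := hl
    have hr' := hr
    rw [Interp.code_subst] at hl' hr'
    exact (h.toFun_congr (M.code_subst t ρ _) rfl _ hl').trans
      ((h.map_tyAx e he _ hs v hl' hr').trans
        (h.toFun_congr (M.code_subst t ρ _).symm rfl hr' _))
  | tmEq_refl _ _ => trivial
  | tmEq_symm _ _ => trivial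
  | tmEq_trans _ _ _ _ => trivial
  | tmEq_conv _ _ _ _ => trivial
  | op_congr _ _ _ _ _ _ _ _ _ => trivial
  | tmAx _ _ _ _ _ _ _ _ _ _ _ => trivial

theorem mapPt_ctx (h : PreHom M N) {n : ℕ} {Γ : Ctx T.sig n} (hΓ : Derivable T (.ctx Γ))
    {ρ : Fin n → M.V} (hρ : M.Sat Γ ρ) (i : Fin n) :
    (h.mapPt ⟨M.code ρ (Γ i), ρ i, hρ i⟩).code = N.code (h.env Γ ρ hρ) (Γ i) :=
  h.sound hΓ ρ hρ i

theorem sat_env (h : PreHom M N) {n : ℕ} {Γ : Ctx T.sig n} (hΓ : Derivable T (.ctx Γ))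
    {ρ : Fin n → M.V} (hρ : M.Sat Γ ρ) : N.Sat Γ (h.env Γ ρ hρ) := fun i => by
  rw [← h.mapPt_ctx hΓ hρ i]
  exact (h.mapPt _).mem

theorem mapPt_ty (h : PreHom M N) {n : ℕ} {Γ : Ctx T.sig n} {A : Ty T.sig n}
    (hA : Derivable T (.ty Γ A)) {ρ : Fin n → M.V} (hρ : M.Sat Γ ρ) {v : M.V}
    (hv : v ∈ M.El (M.code ρ A)) :
    (h.mapPt ⟨M.code ρ A, v, hv⟩).code = N.code (h.env Γ ρ hρ) A :=
  h.sound hA ρ hρ v hv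

theorem toFun_mem_ty (h : PreHom M N) {n : ℕ} {Γ : Ctx T.sig n} {A : Ty T.sig n}
    (hA : Derivable T (.ty Γ A)) {ρ : Fin n → M.V} (hρ : M.Sat Γ ρ) {v : M.V}
    (hv : v ∈ M.El (M.code ρ A)) :
    h.toFun (M.code ρ A) v hv ∈ N.El (N.code (h.env Γ ρ hρ) A) :=
  h.mapPt_ty hA hρ hv ▸ (h.mapPt _).mem

end PreHom

namespace Hom

/-- The action on elements of semantic types. -/
abbrev mapPt {T : PreGAT.{u}} {M N : Model T} (h : Hom M N) (x : M.Pt) : N.Pt :=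
  h.toPreHom.mapPt x

theorem ext_mapPt {T : PreGAT.{u}} {M N : Model T} {h k : Hom M N}
    (e : ∀ x, h.mapPt x = k.mapPt x) : h = k :=
  Hom.ext (funext fun c => funext fun v => funext fun hv =>
    congrArg Interp.Pt.val (e ⟨c, v, hv⟩))

theorem mapPt_comp {T : GAT.{u}} {L M N : T.Alg} (h : L ⟶ M) (k : M ⟶ N) (x : L.model.Pt) :
    Hom.mapPt (h ≫ k : Hom L.model N.model) x = Hom.mapPt k (Hom.mapPt h x) :=
  Interp.Pt.ext (congrArg (Sigma.mk x.code.1)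
    (mapEnv_compFun h k (T.wf.srt x.code.1) (L.model.sat_of_mem _ _ _ x.mem))) rfl

/-- A total map that respects the families and the operations is a homomorphism. -/
def ofMap {T : PreGAT.{u}} {M N : Model T} (φ : M.V → N.V)
    (hfam : ∀ S p v, v ∈ M.fam S p → φ v ∈ N.fam S fun i => φ (p i))
    (hop : ∀ f p, φ (M.op f p) = N.op f fun i => φ (p i)) : Hom M N where
  toFun _ v _ := φ v
  map_mem c v hv := hfam c.1 c.2 v hv
  map_op f p _ := hop f p
  map_tyAx _ _ _ _ _ _ _ := rfl

end Hom

/-! ## Limits of models -/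

namespace Alg

variable {T : GAT.{u}}

section limit

variable {J : Type u} [SmallCategory J] (F : J ⥤ T.Alg)

/-- Compatible families of elements. -/
def limitInterp : Interp T.sig where
  V := ∀ j, (F.obj j).model.V
  fam S p := {v | ∃ h : ∀ j, v j ∈ (F.obj j).model.fam S fun i => p i j,
    ∀ ⦃j k : J⦄ (f : j ⟶ k),
      Hom.mapPt (F.map f) ⟨⟨S, fun i => p i j⟩, v j, h j⟩ = ⟨⟨S, fun i => p i k⟩, v k, h k⟩}
  op f p j := (F.obj j).model.op f fun i => p i j

variable {F}

theorem limitInterp_eval {n : ℕ} (ρ : Fin n → (limitInterp F).V) (t : Term T.sig n) (j : J) :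
    (limitInterp F).eval ρ t j = (F.obj j).model.eval (fun i => ρ i j) t := by
  induction t with
  | var i => rfl
  | op f args ih => exact congrArg ((F.obj j).model.op f) (funext ih)

theorem limitInterp_mem {n : ℕ} {A : Ty T.sig n} {ρ : Fin n → (limitInterp F).V}
    {v : (limitInterp F).V} (hv : v ∈ (limitInterp F).El ((limitInterp F).code ρ A)) :
    ∃ h : ∀ j, v j ∈ (F.obj j).model.El ((F.obj j).model.code (fun i => ρ i j) A),
      ∀ ⦃j k⦄ (f : j ⟶ k), Hom.toFun (F.map f) _ (v j) (h j) = v k := by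
  have e : ∀ j, (fun i => (limitInterp F).eval ρ (A.args i) j) =
      fun i => (F.obj j).model.eval (fun i => ρ i j) (A.args i) := fun j =>
    funext fun i => limitInterp_eval ρ (A.args i) j
  obtain ⟨h, h'⟩ := hv
  refine ⟨fun j => (congrArg (fun q => v j ∈ (F.obj j).model.fam A.srt q) (e j)).mp (h j), fun j k f => ?_⟩
  refine Eq.trans ?_ (congrArg Interp.Pt.val (h' f))
  exact Hom.toFun_congr _ (congrArg (Sigma.mk A.srt) (e j).symm) rfl _ _

/-- Membership in the limit is an equality of points, so the transition maps must match the semantic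
types (`hc`) as well as the values (`hv`). -/
theorem mem_limitInterp {n : ℕ} {A : Ty T.sig n} {ρ : Fin n → (limitInterp F).V}
    {v : (limitInterp F).V}
    (h : ∀ j, v j ∈ (F.obj j).model.El ((F.obj j).model.code (fun i => ρ i j) A))
    (hc : ∀ ⦃j k⦄ (f : j ⟶ k), (Hom.mapPt (F.map f) ⟨_, v j, h j⟩).code =
      (F.obj k).model.code (fun i => ρ i k) A)
    (hv : ∀ ⦃j k⦄ (f : j ⟶ k), Hom.toFun (F.map f) _ (v j) (h j) = v k) :
    v ∈ (limitInterp F).El ((limitInterp F).code ρ A) := by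
  have e : ∀ j, (fun i => (limitInterp F).eval ρ (A.args i) j) =
      fun i => (F.obj j).model.eval (fun i => ρ i j) (A.args i) := fun j =>
    funext fun i => limitInterp_eval ρ (A.args i) j
  refine ⟨fun j => (congrArg (fun q => v j ∈ (F.obj j).model.fam A.srt q) (e j)).mpr (h j), fun j k f => ?_⟩
  refine Interp.Pt.ext ?_ ?_
  · refine Eq.trans (PreHom.mapPt_code_congr _ (y := ⟨_, v j, h j⟩)
      (congrArg (Sigma.mk A.srt) (e j))) ?_
    exact (hc f).trans (congrArg (Sigma.mk A.srt) (e k).symm)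
  · refine Eq.trans ?_ (hv f)
    exact Hom.toFun_congr _ (congrArg (Sigma.mk A.srt) (e j)) rfl _ _

theorem limitInterp_sat {n : ℕ} {Γ : Ctx T.sig n} {ρ : Fin n → (limitInterp F).V}
    (h : (limitInterp F).Sat Γ ρ) :
    ∃ hρ : ∀ j, (F.obj j).model.Sat Γ fun i => ρ i j,
      ∀ ⦃j k⦄ (f : j ⟶ k), Hom.env (F.map f) Γ (fun i => ρ i j) (hρ j) = fun i => ρ i k := by
  choose h h' using fun i => limitInterp_mem (h i)
  exact ⟨fun j i => h i j, fun j k f => funext fun i => h' i f⟩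

/-- Over a derivable context, soundness of the transition maps derives the compatibility of semantic
types from that of the entries. -/
theorem sat_limitInterp {n : ℕ} {Γ : Ctx T.sig n} (hΓ : Derivable T.toPreGAT (.ctx Γ))
    {ρ : Fin n → (limitInterp F).V} (hρ : ∀ j, (F.obj j).model.Sat Γ fun i => ρ i j)
    (hc : ∀ ⦃j k⦄ (f : j ⟶ k),
      Hom.env (F.map f) Γ (fun i => ρ i j) (hρ j) = fun i => ρ i k) :
    (limitInterp F).Sat Γ ρ := fun i =>
  mem_limitInterp (fun j => hρ j i)
    (fun j k f => (PreHom.mapPt_ctx _ hΓ (hρ j) i).trans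
      (congrArg (fun q => (F.obj k).model.code q (Γ i)) (hc f)))
    (fun _ _ f => congrFun (hc f) i)

theorem mem_limitInterp_ty {n : ℕ} {Γ : Ctx T.sig n} {A : Ty T.sig n}
    (hA : Derivable T.toPreGAT (.ty Γ A)) {ρ : Fin n → (limitInterp F).V}
    (hρ : (limitInterp F).Sat Γ ρ) {v : (limitInterp F).V}
    (h : ∀ j, v j ∈ (F.obj j).model.El ((F.obj j).model.code (fun i => ρ i j) A))
    (hv : ∀ ⦃j k⦄ (f : j ⟶ k), Hom.toFun (F.map f) _ (v j) (h j) = v k) :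
    v ∈ (limitInterp F).El ((limitInterp F).code ρ A) := by
  obtain ⟨hρ, hc⟩ := limitInterp_sat hρ
  exact mem_limitInterp h (fun j k f => (PreHom.mapPt_ty _ hA (hρ j) (h j)).trans
    (congrArg (fun q => (F.obj k).model.code q A) (hc f))) hv

variable (F)

/-- The limit of a diagram of models. -/
def limitModel : Model T.toPreGAT where
  toInterp := limitInterp F
  sat_of_mem S p v hv := by
    obtain ⟨h, h'⟩ := hv
    refine sat_limitInterp (T.wf.srt S) (fun j => (F.obj j).model.sat_of_mem S _ _ (h j)) ?_
    intro j k f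
    -- An equality of points contains the equality of parameters, which is the compatibility
    -- required of an element of the context.
    exact eq_of_heq (Sigma.mk.inj (congrArg Interp.Pt.code (h' f))).2
  op_mem f p hp := by
    obtain ⟨hρ, hc⟩ := limitInterp_sat hp
    refine mem_limitInterp_ty (T.wf.op f) hp (fun j => (F.obj j).model.op_mem f _ (hρ j)) ?_
    intro j k g
    exact (Hom.map_op (F.map g) f _ (hρ j)).trans (congrArg ((F.obj k).model.op f) (hc g))
  tyAx e he ρ hp := by
    obtain ⟨hρ, hc⟩ := limitInterp_sat hp
    obtain ⟨hl, hr⟩ := T.wf.tyAx e he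
    have E j := (F.obj j).model.tyAx e he _ (hρ j)
    ext v
    constructor
    · intro hv
      obtain ⟨h, h'⟩ := limitInterp_mem hv
      refine mem_limitInterp_ty hr hp (fun j => E j ▸ h j) fun j k f => ?_
      exact (Hom.map_tyAx (F.map f) e he _ (hρ j) _ (h j) _).symm.trans (h' f)
    · intro hv
      obtain ⟨h, h'⟩ := limitInterp_mem hv
      refine mem_limitInterp_ty hl hp (fun j => (E j).symm ▸ h j) fun j k f => ?_
      exact (Hom.map_tyAx (F.map f) e he _ (hρ j) _ _ (h j)).trans (h' f)
  tmAx e he ρ hp := by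
    obtain ⟨hρ, hc⟩ := limitInterp_sat hp
    funext j
    rw [limitInterp_eval, limitInterp_eval]
    exact (F.obj j).model.tmAx e he _ (hρ j)

/-- The projections of the limit. -/
def limitProj (j : J) : (⟨limitModel F⟩ : T.Alg) ⟶ F.obj j :=
  Hom.ofMap (M := limitModel F) (N := (F.obj j).model) (fun v => v j)
    (fun _ _ _ hv => hv.1 j) (fun _ _ => rfl)

/-- The limit cone of a diagram of models. -/
def limitCone : Cone F where
  pt := ⟨limitModel F⟩
  π :=
    { app j := limitProj F j
      naturality j k f := by
        refine (Category.id_comp _).trans (Hom.ext_mapPt fun x => ?_)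
        refine Eq.trans ?_ (Hom.mapPt_comp (limitProj F j) (F.map f) x).symm
        obtain ⟨⟨S, p⟩, v, h, h'⟩ := x
        exact (h' f).symm }

/-- `limitCone F` is a limit cone. -/
def limitConeIsLimit : IsLimit (limitCone F) where
  lift s :=
    { toFun c v hv j := Hom.toFun (s.π.app j) c v hv
      map_mem c v hv := by
        refine ⟨fun j => Hom.map_mem (s.π.app j) c v hv, fun j k f => ?_⟩
        have := Hom.mapPt_comp (s.π.app j) (F.map f) ⟨c, v, hv⟩
        rw [s.w f] at this
        exact this.symm
      map_op f p hp := funext fun j => Hom.map_op (s.π.app j) f p hp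
      map_tyAx e he ρ hρ v hl hr := funext fun j => Hom.map_tyAx (s.π.app j) e he ρ hρ v hl hr }
  fac s j := rfl
  uniq s m hm := by
    refine Hom.ext (funext fun c => funext fun v => funext fun hv => funext fun j => ?_)
    exact congrArg (fun h : s.pt ⟶ F.obj j => Hom.toFun h c v hv) (hm j)

end limit

instance : HasLimits T.Alg where
  has_limits_of_shape _ _ := ⟨fun F => ⟨⟨⟨_, limitConeIsLimit F⟩⟩⟩⟩

/-! ## The elements of a sort -/

/-- The elements of the sort `S`, together with their parameters. -/
def elts (T : GAT.{u}) (S : T.sig.Srt) : T.Alg ⥤ Type u where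
  obj M := {x : (Fin (T.sig.srtArity S) → M.model.V) × M.model.V // x.2 ∈ M.model.fam S x.1}
  map {M N} h := ↾fun x => ⟨(Hom.env h (T.srtCtx S) x.1.1 (M.model.sat_of_mem S _ _ x.2),
    Hom.toFun h ⟨S, x.1.1⟩ x.1.2 x.2), Hom.map_mem h ⟨S, x.1.1⟩ x.1.2 x.2⟩
  map_id _ := rfl
  map_comp {L M N} h k := by
    refine ConcreteCategory.hom_ext _ _ fun x => ?_
    apply Subtype.ext
    refine Prod.ext ?_ rfl
    exact Hom.mapEnv_compFun h k (T.wf.srt S) (L.model.sat_of_mem _ _ _ x.2)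

/-- An element of a sort as an element of a semantic type. -/
def toPt {S : T.sig.Srt} {M : T.Alg} (x : (elts T S).obj M) : M.model.Pt :=
  ⟨⟨S, x.1.1⟩, x.1.2, x.2⟩

theorem toPt_injective {S : T.sig.Srt} {M : T.Alg} {x y : (elts T S).obj M}
    (h : toPt x = toPt y) : x = y := by
  obtain ⟨⟨p, v⟩, hv⟩ := x
  obtain ⟨⟨q, w⟩, hw⟩ := y
  cases h
  rfl

/-- A compatible family in the diagram of elements carries compatible parameters, which is what
membership in `limitInterp` asks for. -/
instance (S : T.sig.Srt) : PreservesLimits (elts T S) where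
  preservesLimitsOfShape := ⟨fun {F} => preservesLimit_of_preserves_limit_cone
    (limitConeIsLimit F) <| Classical.choice <| (Types.isLimit_iff _).2 fun s hs => by
      have hs' : ∀ ⦃j k⦄ (f : j ⟶ k), Hom.mapPt (F.map f) (toPt (s j)) = toPt (s k) :=
        fun j k f => congrArg toPt (hs f)
      refine ⟨⟨(fun i j => (s j).1.1 i, fun j => (s j).1.2), fun j => (s j).2, hs'⟩,
        fun j => rfl, fun y hy => ?_⟩
      refine Subtype.ext (Prod.ext (funext fun i => funext fun j => ?_) (funext fun j => ?_))
      · exact congrArg (fun x => x.1.1 i) (hy j)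
      · exact congrArg (fun x => x.1.2) (hy j)⟩

end Alg

/-! ## Weakly initial models and solution sets -/

/-- Closed raw terms over a set of generators. -/
inductive Raw (σ : Signature.{u}) (G : Type u) : Type u where
  | gen (g : G) : Raw σ G
  | op (f : σ.Op) (args : Fin (σ.opArity f) → Raw σ G) : Raw σ G

/-- The value of a closed raw term under an assignment of the generators. -/
def Raw.eval {σ : Signature.{u}} {G : Type u} (M : Interp σ) (φ : G → M.V) : Raw σ G → M.V
  | .gen g => φ g
  | .op f args => M.op f fun j => (args j).eval M φ

section free

variable {T : PreGAT.{u}} {G : Type u} (Q : ∀ M : Model T, (G → M.V) → Prop)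

/-- Two raw terms are identified when they agree under all assignments in the class `Q`. -/
def freeSetoid : Setoid (Raw T.sig G) where
  r s t := ∀ M φ, Q M φ → s.eval M.toInterp φ = t.eval M.toInterp φ
  iseqv := ⟨fun _ _ _ _ => rfl, fun h M φ hφ => (h M φ hφ).symm,
    fun h k M φ hφ => (h M φ hφ).trans (k M φ hφ)⟩

variable {Q} in
/-- Evaluation of classes of raw terms. -/
def freeEval (M : Model T) (φ : G → M.V) (hφ : Q M φ) : Quotient (freeSetoid Q) → M.V :=
  Quotient.lift (Raw.eval M.toInterp φ) fun _ _ h => h M φ hφ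

/-- Classes of raw terms, with everything that holds under all assignments in the class `Q`. -/
noncomputable def freeInterp : Interp T.sig where
  V := Quotient (freeSetoid Q)
  fam S p := {v | ∀ M φ (hφ : Q M φ),
    freeEval M φ hφ v ∈ M.fam S fun i => freeEval M φ hφ (p i)}
  op f p := Quotient.mk _ (.op f fun i => (p i).out)

variable {Q}

/-- The representatives chosen by `Quotient.out` are invisible here: equivalent raw terms have the
same value under every assignment in `Q`. -/
theorem freeEval_op (M : Model T) (φ : G → M.V) (hφ : Q M φ) (f : T.sig.Op)
    (p : Fin (T.sig.opArity f) → (freeInterp Q).V) :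
    freeEval M φ hφ ((freeInterp Q).op f p) = M.op f fun i => freeEval M φ hφ (p i) := by
  refine congrArg (M.op f) (funext fun i => ?_)
  conv_rhs => rw [← Quotient.out_eq (p i)]
  rfl

theorem freeEval_eval (M : Model T) (φ : G → M.V) (hφ : Q M φ) {n : ℕ}
    (ρ : Fin n → (freeInterp Q).V) (t : Term T.sig n) :
    freeEval M φ hφ ((freeInterp Q).eval ρ t) = M.eval (fun i => freeEval M φ hφ (ρ i)) t := by
  induction t with
  | var i => rfl
  | op f args ih => exact (freeEval_op M φ hφ f _).trans (congrArg (M.op f) (funext ih))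

/-- The assignments in `Q` jointly separate classes, so an identity between classes can be checked
in each `M` separately. The quotient stays in `Type u` although the models range over a larger
universe. -/
theorem freeEval_injective {v w : (freeInterp Q).V}
    (h : ∀ M φ (hφ : Q M φ), freeEval M φ hφ v = freeEval M φ hφ w) : v = w := by
  induction v using Quotient.inductionOn
  induction w using Quotient.inductionOn
  exact Quotient.sound h

theorem mem_freeInterp_iff {n : ℕ} (ρ : Fin n → (freeInterp Q).V) (A : Ty T.sig n)
    (v : (freeInterp Q).V) :
    v ∈ (freeInterp Q).El ((freeInterp Q).code ρ A) ↔ ∀ M φ (hφ : Q M φ),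
      freeEval M φ hφ v ∈ M.El (M.code (fun i => freeEval M φ hφ (ρ i)) A) := by
  refine forall_congr' fun M => forall_congr' fun φ => forall_congr' fun hφ => ?_
  simp only [Interp.code, freeEval_eval, Interp.El]

theorem sat_freeInterp_iff {n : ℕ} (ρ : Fin n → (freeInterp Q).V) (Γ : Ctx T.sig n) :
    (freeInterp Q).Sat Γ ρ ↔ ∀ M φ (hφ : Q M φ), M.Sat Γ fun i => freeEval M φ hφ (ρ i) := by
  simp only [Interp.Sat, mem_freeInterp_iff]
  exact ⟨fun h M φ hφ i => h i M φ hφ, fun h i M φ hφ => h M φ hφ i⟩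

variable (Q)

/-- The model of classes of raw terms. -/
noncomputable def freeModel : Model T where
  toInterp := freeInterp Q
  sat_of_mem S p v hv := (sat_freeInterp_iff _ _).2 fun M φ hφ => M.sat_of_mem S _ _ (hv M φ hφ)
  op_mem f p hp := (mem_freeInterp_iff _ _ _).2 fun M φ hφ => by
    rw [freeEval_op]
    exact M.op_mem f _ ((sat_freeInterp_iff _ _).1 hp M φ hφ)
  tyAx e he ρ hρ := by
    ext v
    rw [mem_freeInterp_iff, mem_freeInterp_iff]
    refine forall_congr' fun M => forall_congr' fun φ => forall_congr' fun hφ => ?_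
    rw [M.tyAx e he _ ((sat_freeInterp_iff _ _).1 hρ M φ hφ)]
  tmAx e he ρ hρ := freeEval_injective fun M φ hφ => by
    rw [freeEval_eval, freeEval_eval]
    exact M.tmAx e he _ ((sat_freeInterp_iff _ _).1 hρ M φ hφ)

variable {Q}

/-- The homomorphism given by an assignment in the class `Q`. -/
noncomputable def freeHom (M : Model T) (φ : G → M.V) (hφ : Q M φ) : Hom (freeModel Q) M :=
  Hom.ofMap (freeEval M φ hφ) (fun _ _ _ hv => hv M φ hφ) (freeEval_op M φ hφ)

end free

/-! ### Left adjoints of the element functors, and colimits of models. -/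

namespace Alg

variable {T : GAT.{u}}

theorem elts_solutionSetCondition (S : T.sig.Srt) :
    SolutionSetCondition.{u} (elts T S) := by
  intro A
  -- Each `a` contributes one generator `none` for the element and one generator `some i` for each
  -- parameter. `Q` asks only that these be correctly typed, so a single weakly initial model is a
  -- solution set.
  let G : Type u := A × Option (Fin (T.sig.srtArity S))
  let Q : ∀ M : Model T.toPreGAT, (G → M.V) → Prop := fun M φ =>
    ∀ a, φ (a, none) ∈ M.fam S fun i => φ (a, some i)
  refine ⟨PUnit, fun _ => ⟨freeModel Q⟩, fun _ => ↾fun a =>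
    ⟨(fun i => Quotient.mk _ (.gen (a, some i)), Quotient.mk _ (.gen (a, none))),
      fun M φ hφ => hφ a⟩, fun X h => ?_⟩
  refine ⟨⟨⟩, freeHom (Q := Q) X.model
    (fun g => g.2.elim (h g.1).1.2 (h g.1).1.1) (fun a => (h a).2), ?_⟩
  rfl

instance (S : T.sig.Srt) : (elts T S).IsRightAdjoint :=
  isRightAdjoint_of_preservesLimits_of_solutionSetCondition _ (elts_solutionSetCondition S)

theorem const_solutionSetCondition (J : Type u) [SmallCategory J] :
    SolutionSetCondition.{u} (Functor.const J : T.Alg ⥤ J ⥤ T.Alg) := by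
  intro F
  let G : Type u := Σ j, (F.obj j).model.Pt
  let φ : ∀ X : T.Alg, (F ⟶ (Functor.const J).obj X) → G → X.model.V := fun X h g =>
    Hom.toFun (h.app g.1) g.2.code g.2.val g.2.mem
  -- The admissible assignments are those induced by cocones on `F`. The laws of the cocone `ι` then
  -- hold in the model of raw terms because they hold in every cocone.
  let Q : ∀ M : Model T.toPreGAT, (G → M.V) → Prop := fun M ψ =>
    ∃ h : F ⟶ (Functor.const J).obj ⟨M⟩, φ ⟨M⟩ h = ψ
  let ι : F ⟶ (Functor.const J).obj ⟨freeModel Q⟩ :=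
    { app j :=
        { toFun c v hv := Quotient.mk _ (.gen ⟨j, ⟨c, v, hv⟩⟩)
          map_mem c v hv := by
            rintro M _ ⟨h, rfl⟩
            exact Hom.map_mem (h.app j) c v hv
          map_op f p hp := freeEval_injective (Q := Q) (by
            rintro M _ ⟨h, rfl⟩
            exact (Hom.map_op (h.app j) f p hp).trans (freeEval_op (Q := Q) M _ ⟨h, rfl⟩ f
              fun i => Quotient.mk _ (.gen ⟨j, _, p i, hp i⟩)).symm)
          map_tyAx e he ρ hρ v hl hr := freeEval_injective (Q := Q) (by
            rintro M _ ⟨h, rfl⟩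
            exact Hom.map_tyAx (h.app j) e he ρ hρ v hl hr) }
      naturality j k f := by
        refine Eq.trans ?_ (Category.comp_id _).symm
        refine Hom.ext (funext fun c => funext fun v => funext fun hv =>
          freeEval_injective (Q := Q) ?_)
        rintro M _ ⟨h, rfl⟩
        exact congrArg (fun g : F.obj j ⟶ ⟨M⟩ => Hom.toFun g c v hv)
          ((h.naturality f).trans (Category.comp_id _)) }
  refine ⟨PUnit, fun _ => ⟨freeModel Q⟩, fun _ => ι, fun X h => ?_⟩
  exact ⟨⟨⟩, freeHom (Q := Q) X.model (φ X h) ⟨h, rfl⟩, rfl⟩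

instance : HasColimits T.Alg where
  has_colimits_of_shape J _ := hasColimitsOfShape_iff_isRightAdjoint_const.2
    (isRightAdjoint_of_preservesLimits_of_solutionSetCondition _ (const_solutionSetCondition J))

end Alg

/-! ## Filtered colimits of models -/

/-- This is where finiteness of contexts meets filteredness: finitely many stable conditions are
achieved at one common stage. -/
theorem exists_hom_forall_fin {J : Type u} [SmallCategory J] [IsFiltered J] {j : J} {n : ℕ}
    {P : Fin n → ∀ k, (j ⟶ k) → Prop} (hP : ∀ i k f l (g : k ⟶ l), P i k f → P i l (f ≫ g))
    (h : ∀ i, ∃ k f, P i k f) : ∃ k f, ∀ i, P i k f := by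
  induction n with
  | zero => exact ⟨j, 𝟙 j, fun i => i.elim0⟩
  | succ n ih =>
    obtain ⟨k, f, hk⟩ := ih (fun i => hP i.succ) (fun i => h i.succ)
    obtain ⟨k', f', hk'⟩ := h 0
    obtain ⟨l, g, g', e⟩ := IsFiltered.span f f'
    refine ⟨l, f ≫ g, fun i => Fin.cases ?_ (fun i => hP _ _ _ _ _ (hk i)) i⟩
    rw [e]
    exact hP _ _ _ _ _ hk'

/-- `ι` exhibits the elements of the semantic types of `I` as the filtered colimit of those of
the models `F.obj j`. -/
structure IsFilteredColimit {T : GAT.{u}} {J : Type u} [SmallCategory J] {F : J ⥤ T.Alg}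
    {I : Interp T.sig} (ι : ∀ j, PreHom (F.obj j).model I) : Prop where
  nat : ∀ ⦃j k⦄ (f : j ⟶ k) x, (ι k).mapPt (Hom.mapPt (F.map f) x) = (ι j).mapPt x
  surj : ∀ S p v, v ∈ I.fam S p → ∃ j q w, ∃ hw : w ∈ (F.obj j).model.fam S q,
    (ι j).env (T.srtCtx S) q ((F.obj j).model.sat_of_mem S q w hw) = p ∧
      (ι j).toFun ⟨S, q⟩ w hw = v
  inj : ∀ j x y, (ι j).mapPt x = (ι j).mapPt y →
    ∃ (k : J) (f : j ⟶ k), Hom.mapPt (F.map f) x = Hom.mapPt (F.map f) y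

theorem Interp.Sat.snoc {σ : Signature.{u}} {M : Interp σ} {n : ℕ} {Γ : Ctx σ n} {A : Ty σ n}
    {ρ : Fin (n + 1) → M.V} (h : M.Sat Γ fun i => ρ i.castSucc)
    (hl : ρ (Fin.last n) ∈ M.El (M.code (fun i => ρ i.castSucc) A)) : M.Sat (Γ.snoc A) ρ :=
  Fin.lastCases (by rwa [Interp.code_snoc_last]) fun i => by
    rw [Interp.code_snoc_castSucc]; exact h i

theorem Derivable.ctx_of_tm {T : PreGAT.{u}} {n : ℕ} {Γ : Ctx T.sig n} {t : Term T.sig n}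
    {A : Ty T.sig n} (h : Derivable T (.tm Γ t A)) : Derivable T (.ctx Γ) := by
  generalize hJ : Judgment.tm Γ t A = K at h
  induction h generalizing t A with
  | var i hΓ _ => cases hJ; exact hΓ
  | op f t _ hΓ _ _ _ _ => cases hJ; exact hΓ
  | conv _ _ ih _ => cases hJ; exact ih rfl
  | _ => cases hJ

/-! ### Lifting elements of contexts to a stage; filtered colimits are models. -/

namespace IsFilteredColimit

variable {T : GAT.{u}} {J : Type u} [SmallCategory J] {F : J ⥤ T.Alg}
  {I : Interp T.sig} {ι : ∀ j, PreHom (F.obj j).model I}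

theorem exists_mapPt (hι : IsFilteredColimit ι) (z : I.Pt) : ∃ j x, (ι j).mapPt x = z := by
  obtain ⟨⟨S, p⟩, v, hv⟩ := z
  obtain ⟨j, q, w, hw, rfl, rfl⟩ := hι.surj S p v hv
  exact ⟨j, ⟨⟨S, q⟩, w, hw⟩, rfl⟩

theorem env_env (hι : IsFilteredColimit ι) {j k : J} (f : j ⟶ k) {n : ℕ} {Γ : Ctx T.sig n}
    (hΓ : Derivable T.toPreGAT (.ctx Γ)) {ρ : Fin n → (F.obj j).model.V}
    (hρ : (F.obj j).model.Sat Γ ρ) :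
    (ι k).env Γ (Hom.env (F.map f) Γ ρ hρ) (Hom.sat_env (F.map f) hΓ hρ) = (ι j).env Γ ρ hρ := by
  funext i
  refine Eq.trans ?_ (congrArg Interp.Pt.val (hι.nat f ⟨_, ρ i, hρ i⟩))
  exact (ι k).toFun_congr (Hom.mapCode_eq (F.map f) hΓ hρ i).symm rfl _ _

variable [IsFiltered J]

theorem env_inj (hι : IsFilteredColimit ι) {j k : J} {n : ℕ} {Γ : Ctx T.sig n}
    (hΓ : Derivable T.toPreGAT (.ctx Γ)) {ρ : Fin n → (F.obj j).model.V}
    (hρ : (F.obj j).model.Sat Γ ρ) {τ : Fin n → (F.obj k).model.V}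
    (hτ : (F.obj k).model.Sat Γ τ) (h : (ι j).env Γ ρ hρ = (ι k).env Γ τ hτ) :
    ∃ (l : J) (f : j ⟶ l) (g : k ⟶ l),
      Hom.env (F.map f) Γ ρ hρ = Hom.env (F.map g) Γ τ hτ := by
  let a := IsFiltered.leftToMax j k
  let b := IsFiltered.rightToMax j k
  let x i := Hom.mapPt (F.map a) ⟨_, ρ i, hρ i⟩
  let y i := Hom.mapPt (F.map b) ⟨_, τ i, hτ i⟩
  have key : ∃ (l : J) (c : IsFiltered.max j k ⟶ l), ∀ i,
      Hom.mapPt (F.map c) (x i) = Hom.mapPt (F.map c) (y i) := by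
    refine exists_hom_forall_fin ?_ fun i => hι.inj _ _ _ ?_
    · intro i l f l' g e
      rw [F.map_comp, Hom.mapPt_comp, Hom.mapPt_comp, e]
    · rw [hι.nat, hι.nat]
      -- The semantic types agree too: by soundness each is `Γ i` evaluated at the image
      -- environment, and the two environments agree by `h`.
      refine Interp.Pt.ext ?_ (congrFun h i)
      rw [PreHom.mapPt_ctx _ hΓ, PreHom.mapPt_ctx _ hΓ, h]
  obtain ⟨l, c, hc⟩ := key
  refine ⟨l, a ≫ c, b ≫ c, funext fun i => ?_⟩
  have e := hc i
  simp only [x, y, ← Hom.mapPt_comp, ← F.map_comp] at e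
  exact congrArg Interp.Pt.val e

/-- An element of a type over a context that lifts to some stage lifts to some stage. -/
theorem exists_lift_ty (hι : IsFilteredColimit ι) {j : J} {n : ℕ} {Γ : Ctx T.sig n}
    {A : Ty T.sig n} (hΓ : Derivable T.toPreGAT (.ctx Γ)) (hA : Derivable T.toPreGAT (.ty Γ A))
    {ρ : Fin n → (F.obj j).model.V} (hρ : (F.obj j).model.Sat Γ ρ) {v : I.V}
    (hv : v ∈ I.El (I.code ((ι j).env Γ ρ hρ) A)) :
    ∃ (k : J) (τ : Fin n → (F.obj k).model.V) (hτ : (F.obj k).model.Sat Γ τ)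
      (w : (F.obj k).model.V) (hw : w ∈ (F.obj k).model.El ((F.obj k).model.code τ A)),
      (ι k).env Γ τ hτ = (ι j).env Γ ρ hρ ∧ (ι k).toFun _ w hw = v := by
  cases hA with
  | srt S t hS _ ht =>
  -- The parameters `q` of the lift `w` have no relation to `ρ` at first. They have the same image
  -- as the terms `t` evaluated at `ρ`, so `env_inj` makes the two agree at a later stage, to which
  -- `w` is moved.
  obtain ⟨k, q, w, hw, hq, rfl⟩ := hι.surj S _ v hv
  have hm j i := (F.obj j).model.sound (ht i)
  have hs := Interp.sat_subst (hm j) hρ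
  have hq' := ((ι j).env_subst (hm j) (fun i => (ι j).sound (ht i)) hρ hs).trans hq.symm
  obtain ⟨l, f, g, e⟩ := hι.env_inj hS hs _ hq'
  have hf := Hom.sat_env (F.map f) hΓ hρ
  have e' := (Hom.env_subst (F.map f) (hm j) (fun i => Hom.sound (F.map f) (ht i)) hρ hs).symm.trans
    e
  have hw' := Hom.map_mem (F.map g) ⟨S, q⟩ w hw
  have ew : (F.obj l).model.code (Hom.env (F.map f) Γ ρ hρ) ⟨S, t⟩ =
    (Hom.mapPt (F.map g) ⟨⟨S, q⟩, w, hw⟩).code := congrArg (Sigma.mk S) e'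
  refine ⟨l, _, hf, _, (congrArg (_ ∈ (F.obj l).model.El ·) ew).mpr hw', hι.env_env f hΓ hρ, ?_⟩
  refine Eq.trans ?_ (congrArg Interp.Pt.val (hι.nat g ⟨⟨S, q⟩, w, hw⟩))
  exact (ι l).toFun_congr ew rfl _ _

/-- Induction on the length of the context: once the initial segment is lifted, the last entry is an
element of a type over it. Lifting that entry may require a later stage and hence a new lift of the
initial segment. -/
theorem exists_lift (hι : IsFilteredColimit ι) {n : ℕ} {Γ : Ctx T.sig n}
    (hΓ : Derivable T.toPreGAT (.ctx Γ)) {ρ : Fin n → I.V} (hρ : I.Sat Γ ρ) :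
    ∃ (j : J) (τ : Fin n → (F.obj j).model.V) (hτ : (F.obj j).model.Sat Γ τ),
      (ι j).env Γ τ hτ = ρ := by
  induction n with
  | zero =>
    obtain ⟨j⟩ := IsFiltered.nonempty (C := J)
    exact ⟨j, Fin.elim0, fun i => i.elim0, funext fun i => i.elim0⟩
  | succ n ih =>
    cases hΓ with
    | @ctx_snoc _ Γ A hΓ hA =>
    obtain ⟨j, τ, hτ, e⟩ := ih hΓ hρ.castSucc
    have hl := hρ (Fin.last n)
    rw [Interp.code_snoc_last, ← e] at hl
    obtain ⟨k, τ, hτ, w, hw, e', hl'⟩ := hι.exists_lift_ty hΓ hA hτ hl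
    obtain ⟨τ', rfl, rfl⟩ : ∃ τ' : Fin (n + 1) → (F.obj k).model.V,
        (fun i => τ' i.castSucc) = τ ∧ τ' (Fin.last n) = w :=
      ⟨Fin.snoc (α := fun _ => (F.obj k).model.V) τ w,
        funext fun i => Fin.snoc_castSucc (α := fun _ => (F.obj k).model.V) _ _ i,
        Fin.snoc_last (α := fun _ => (F.obj k).model.V) _ _⟩
    refine ⟨k, τ', hτ.snoc hw, funext fun i => ?_⟩
    induction i using Fin.lastCases with
    | last => exact ((ι k).toFun_congr (Interp.code_snoc_last _ τ' Γ A) rfl _ hw).trans hl'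
    | cast i => exact congrFun (((ι k).env_castSucc _).trans (e'.trans e)) i

theorem exists_lift_elt (hι : IsFilteredColimit ι) {n : ℕ} {Γ : Ctx T.sig n}
    {A : Ty T.sig n} (hA : Derivable T.toPreGAT (.ty Γ A)) {ρ : Fin n → I.V} (hρ : I.Sat Γ ρ)
    {v : I.V} (hv : v ∈ I.El (I.code ρ A)) :
    ∃ (j : J) (τ : Fin n → (F.obj j).model.V) (hτ : (F.obj j).model.Sat Γ τ)
      (w : (F.obj j).model.V) (hw : w ∈ (F.obj j).model.El ((F.obj j).model.code τ A)),
      (ι j).env Γ τ hτ = ρ ∧ (ι j).toFun _ w hw = v := by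
  obtain ⟨j, τ, hτ, rfl⟩ := hι.exists_lift hA.ctx_of_ty hρ
  exact hι.exists_lift_ty hA.ctx_of_ty hA hτ hv

/-- A filtered colimit of models is a model. -/
def model (hι : IsFilteredColimit ι) : Model T.toPreGAT where
  toInterp := I
  sat_of_mem S p v hv := by
    obtain ⟨j, q, w, hw, rfl, rfl⟩ := hι.surj S p v hv
    exact (ι j).sat_env (T.wf.srt S) _
  op_mem f p hp := by
    obtain ⟨j, τ, hτ, rfl⟩ := hι.exists_lift (T.wf.op f).ctx_of_ty hp
    rw [← (ι j).map_op f τ hτ]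
    exact (ι j).toFun_mem_ty (T.wf.op f) hτ _
  tyAx e he ρ hρ := by
    obtain ⟨hl, hr⟩ := T.wf.tyAx e he
    ext v
    constructor
    · intro hv
      obtain ⟨j, τ, hτ, w, hw, rfl, rfl⟩ := hι.exists_lift_elt hl hρ hv
      have hw' : w ∈ (F.obj j).model.El _ := (F.obj j).model.tyAx e he τ hτ ▸ hw
      rw [(ι j).map_tyAx e he τ hτ w hw hw']
      exact (ι j).toFun_mem_ty hr hτ _
    · intro hv
      obtain ⟨j, τ, hτ, w, hw, rfl, rfl⟩ := hι.exists_lift_elt hr hρ hv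
      have hw' : w ∈ (F.obj j).model.El _ := (F.obj j).model.tyAx e he τ hτ ▸ hw
      rw [← (ι j).map_tyAx e he τ hτ w hw' hw]
      exact (ι j).toFun_mem_ty hl hτ _
  tmAx e he ρ hρ := by
    obtain ⟨hl, hr⟩ := T.wf.tmAx e he
    obtain ⟨j, τ, hτ, rfl⟩ := hι.exists_lift (hl.ctx_of_tm) hρ
    have ml := (F.obj j).model.sound hl τ hτ
    have mr := (F.obj j).model.sound hr τ hτ
    -- Maps commute with evaluation only for well-typed terms, so well-formedness of both sides of
    -- the axiom is essential.
    rw [← (ι j).sound hl τ hτ ml, ← (ι j).sound hr τ hτ mr]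
    exact (ι j).toFun_congr rfl ((F.obj j).model.tmAx e he τ hτ) _ _

end IsFilteredColimit

/-! ### The universal property of filtered colimits. -/

namespace IsFilteredColimit

variable {T : GAT.{u}} {J : Type u} [SmallCategory J] {F : J ⥤ T.Alg} [IsFiltered J]

/-- The map from a filtered colimit to the vertex of a cocone, on elements. -/
noncomputable def descPt {I : Interp T.sig} {ι : ∀ j, PreHom (F.obj j).model I}
    (hι : IsFilteredColimit ι) (s : Cocone F) (z : I.Pt) : s.pt.model.Pt :=
  Hom.mapPt (s.ι.app (hι.exists_mapPt z).choose) (hι.exists_mapPt z).choose_spec.choose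

/-- The chosen representative does not matter: two representatives can be moved to a common stage,
and `inj` makes them equal at a later one. -/
theorem descPt_mapPt {I : Interp T.sig} {ι : ∀ j, PreHom (F.obj j).model I}
    (hι : IsFilteredColimit ι) (s : Cocone F) {j : J} (x : (F.obj j).model.Pt) :
    hι.descPt s ((ι j).mapPt x) = Hom.mapPt (s.ι.app j) x := by
  have hs : ∀ {j k : J} (f : j ⟶ k) (x : (F.obj j).model.Pt),
      Hom.mapPt (s.ι.app k) (Hom.mapPt (F.map f) x) = Hom.mapPt (s.ι.app j) x := by
    intro j k f x
    rw [← s.w f]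
    exact (Hom.mapPt_comp (F.map f) (s.ι.app k) x).symm
  have key : ∀ {j k : J} (x : (F.obj j).model.Pt) (y : (F.obj k).model.Pt),
      (ι j).mapPt x = (ι k).mapPt y → Hom.mapPt (s.ι.app j) x = Hom.mapPt (s.ι.app k) y := by
    intro j k x y h
    rw [← hι.nat (IsFiltered.leftToMax j k), ← hι.nat (IsFiltered.rightToMax j k)] at h
    obtain ⟨l, f, e⟩ := hι.inj _ _ _ h
    rw [← hs (IsFiltered.leftToMax j k), ← hs (IsFiltered.rightToMax j k), ← hs f, e, hs f]
  exact key _ _ (hι.exists_mapPt ((ι j).mapPt x)).choose_spec.choose_spec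

theorem descPt_env {I : Interp T.sig} {ι : ∀ j, PreHom (F.obj j).model I}
    (hι : IsFilteredColimit ι) (s : Cocone F) {j : J} {n : ℕ} {Γ : Ctx T.sig n}
    (hΓ : Derivable T.toPreGAT (.ctx Γ)) {ρ : Fin n → (F.obj j).model.V}
    (hρ : (F.obj j).model.Sat Γ ρ) (hρ' : I.Sat Γ ((ι j).env Γ ρ hρ)) :
    mapEnv (N := s.pt.model.toInterp) (fun d v hv => (hι.descPt s ⟨d, v, hv⟩).val) Γ
      ((ι j).env Γ ρ hρ) hρ' = Hom.env (s.ι.app j) Γ ρ hρ := by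
  funext i
  refine Eq.trans (congrArg (fun z => (hι.descPt s z).val) ?_)
    (congrArg Interp.Pt.val (hι.descPt_mapPt s ⟨_, ρ i, hρ i⟩))
  exact Interp.Pt.ext ((ι j).mapPt_ctx hΓ hρ i).symm rfl

theorem descPt_ty {I : Interp T.sig} {ι : ∀ j, PreHom (F.obj j).model I}
    (hι : IsFilteredColimit ι) (s : Cocone F) {j : J} {n : ℕ} {Γ : Ctx T.sig n} {A : Ty T.sig n}
    (hA : Derivable T.toPreGAT (.ty Γ A)) {ρ : Fin n → (F.obj j).model.V}
    (hρ : (F.obj j).model.Sat Γ ρ) {v : (F.obj j).model.V}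
    (hv : v ∈ (F.obj j).model.El ((F.obj j).model.code ρ A)) {w : I.V}
    (hw : w ∈ I.El (I.code ((ι j).env Γ ρ hρ) A)) (e : (ι j).toFun _ v hv = w) :
    (hι.descPt s ⟨_, w, hw⟩).val = Hom.toFun (s.ι.app j) _ v hv := by
  refine Eq.trans (congrArg (fun z => (hι.descPt s z).val) ?_)
    (congrArg Interp.Pt.val (hι.descPt_mapPt s ⟨_, v, hv⟩))
  exact Interp.Pt.ext ((ι j).mapPt_ty hA hρ hv).symm e.symm

/-- The homomorphism from a filtered colimit to the vertex of a cocone. -/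
noncomputable def descHom {M : Model T.toPreGAT} {ι : ∀ j, PreHom (F.obj j).model M.toInterp}
    (hι : IsFilteredColimit ι) (s : Cocone F) : Hom M s.pt.model where
  toFun d v hv := (hι.descPt s ⟨d, v, hv⟩).val
  map_mem := by
    rintro ⟨S, p⟩ v hv
    obtain ⟨j, q, w, hw, rfl, rfl⟩ := hι.surj S p v hv
    have h := Hom.map_mem (s.ι.app j) ⟨S, q⟩ w hw
    have e₁ := hι.descPt_env s (T.wf.srt S) ((F.obj j).model.sat_of_mem S q w hw)
      (M.sat_of_mem _ _ _ hv)
    have e₂ := congrArg Interp.Pt.val (hι.descPt_mapPt s ⟨⟨S, q⟩, w, hw⟩)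
    exact Set.mem_of_eq_of_mem e₂ (congrArg (s.pt.model.fam S) e₁ ▸ h)
  map_op f p hp := by
    obtain ⟨j, τ, hτ, rfl⟩ := hι.exists_lift (T.wf.op f).ctx_of_ty hp
    refine Eq.trans ?_ (congrArg (s.pt.model.op f)
      (hι.descPt_env s (T.wf.op f).ctx_of_ty hτ hp).symm)
    refine Eq.trans ?_ (Hom.map_op (s.ι.app j) f τ hτ)
    exact hι.descPt_ty s (T.wf.op f) hτ _ _ ((ι j).map_op f τ hτ)
  map_tyAx e he ρ hρ v hl hr := by
    obtain ⟨wl, wr⟩ := T.wf.tyAx e he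
    obtain ⟨j, τ, hτ, w, hw, rfl, rfl⟩ := hι.exists_lift_elt wl hρ hl
    have hw' : w ∈ (F.obj j).model.El _ := (F.obj j).model.tyAx e he τ hτ ▸ hw
    refine (hι.descPt_ty s wl hτ hw hl rfl).trans ?_
    refine (Hom.map_tyAx (s.ι.app j) e he τ hτ w hw hw').trans ?_
    exact (hι.descPt_ty s wr hτ hw' hr ((ι j).map_tyAx e he τ hτ w hw hw').symm).symm

/-- A cocone of models that is a filtered colimit on elements is a colimit. -/
noncomputable def isColimit {c : Cocone F}
    (hc : IsFilteredColimit fun j =>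
      Hom.toPreHom (M := (F.obj j).model) (N := c.pt.model) (c.ι.app j)) : IsColimit c where
  desc s := hc.descHom s
  fac s j := Hom.ext (funext fun d => funext fun v => funext fun hv =>
    congrArg Interp.Pt.val (hc.descPt_mapPt s ⟨d, v, hv⟩))
  uniq s m hm := by
    refine Hom.ext (funext fun d => funext fun v => funext fun hv => ?_)
    obtain ⟨S, p⟩ := d
    obtain ⟨j, q, w, hw, rfl, rfl⟩ := hc.surj S p v hv
    refine Eq.trans ?_ (congrArg Interp.Pt.val (hc.descPt_mapPt s ⟨⟨S, q⟩, w, hw⟩)).symm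
    exact congrArg (fun h : F.obj j ⟶ s.pt => Hom.toFun h ⟨S, q⟩ w hw) (hm j)

end IsFilteredColimit

/-! ### Construction of filtered colimits -/

namespace Alg

variable {T : GAT.{u}}

/-- Two elements are indistinguishable if all homomorphisms send them to the same value. -/
def Indist {M : T.Alg} (x y : M.model.Pt) : Prop :=
  ∀ (N : T.Alg) (h : M ⟶ N), (Hom.mapPt h x).val = (Hom.mapPt h y).val

/-- Stability is the reason for quantifying over all homomorphisms. Equality of values alone is not
stable, since a homomorphism may send one value to different places in different semantic types. -/
theorem Indist.map {M N : T.Alg} {x y : M.model.Pt} (h : Indist x y) (f : M ⟶ N) :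
    Indist (Hom.mapPt f x) (Hom.mapPt f y) := fun K g => by
  rw [← Hom.mapPt_comp, ← Hom.mapPt_comp]
  exact h K (f ≫ g)

variable {J : Type u} [SmallCategory J] (F : J ⥤ T.Alg)

/-- Two elements at different stages become indistinguishable at some stage. -/
def ColimRel (x y : Σ j, (F.obj j).model.Pt) : Prop :=
  ∃ (l : J) (f : x.1 ⟶ l) (g : y.1 ⟶ l),
    Indist (Hom.mapPt (F.map f) x.2) (Hom.mapPt (F.map g) y.2)

variable [IsFiltered J]

theorem colimRel_equivalence : Equivalence (ColimRel F) where
  refl x := ⟨x.1, 𝟙 _, 𝟙 _, fun _ _ => rfl⟩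
  symm := fun ⟨l, f, g, h⟩ => ⟨l, g, f, fun N k => (h N k).symm⟩
  trans := by
    rintro x y z ⟨l, f, g, h⟩ ⟨l', f', g', h'⟩
    obtain ⟨m, a, b, e⟩ := IsFiltered.span g f'
    refine ⟨m, f ≫ a, g' ≫ b, ?_⟩
    have h₁ := h.map (F.map a)
    have h₂ := h'.map (F.map b)
    rw [← Hom.mapPt_comp, ← Hom.mapPt_comp, ← F.map_comp, ← F.map_comp] at h₁ h₂
    rw [← e] at h₂
    exact fun N k => (h₁ N k).trans (h₂ N k)

/-- The class of an element in the colimit. -/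
def cls (j : J) (x : (F.obj j).model.Pt) : Set (Σ j, (F.obj j).model.Pt) :=
  {y | ColimRel F ⟨j, x⟩ y}

theorem cls_eq_iff {j k : J} {x : (F.obj j).model.Pt} {y : (F.obj k).model.Pt} :
    cls F j x = cls F k y ↔ ColimRel F ⟨j, x⟩ ⟨k, y⟩ := by
  have E := colimRel_equivalence F
  constructor
  · intro h
    have : (⟨k, y⟩ : Σ j, (F.obj j).model.Pt) ∈ cls F k y := E.refl _
    rwa [← h] at this
  · intro h
    ext z
    exact ⟨fun hz => E.trans (E.symm h) hz, fun hz => E.trans h hz⟩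

theorem cls_map {j k : J} (f : j ⟶ k) (x : (F.obj j).model.Pt) :
    cls F k (Hom.mapPt (F.map f) x) = cls F j x := by
  rw [cls_eq_iff]
  refine ⟨k, 𝟙 k, f, fun N h => ?_⟩
  rw [F.map_id]
  rfl

variable {F} in
theorem exists_indist_of_cls_eq {j : J} {x y : (F.obj j).model.Pt} (h : cls F j x = cls F j y) :
    ∃ (k : J) (f : j ⟶ k), Indist (Hom.mapPt (F.map f) x) (Hom.mapPt (F.map f) y) := by
  obtain ⟨l, f, g, e⟩ := (cls_eq_iff F).1 h
  -- The two legs supplied by `ColimRel` are parallel, and filteredness coequalizes them.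
  refine ⟨_, f ≫ IsFiltered.coeqHom f g, ?_⟩
  have := e.map (F.map (IsFiltered.coeqHom f g))
  rw [← Hom.mapPt_comp, ← Hom.mapPt_comp, ← F.map_comp, ← F.map_comp] at this
  rwa [← IsFiltered.coeq_condition] at this

/-- The classes of the entries of an element of a context. -/
def clsEnv {j : J} {n : ℕ} (Γ : Ctx T.sig n) (ρ : Fin n → (F.obj j).model.V)
    (hρ : (F.obj j).model.Sat Γ ρ) : Fin n → Set (Σ j, (F.obj j).model.Pt) :=
  fun i => cls F j ⟨_, ρ i, hρ i⟩

theorem clsEnv_env {j k : J} (f : j ⟶ k) {n : ℕ} {Γ : Ctx T.sig n}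
    (hΓ : Derivable T.toPreGAT (.ctx Γ)) {ρ : Fin n → (F.obj j).model.V}
    (hρ : (F.obj j).model.Sat Γ ρ) :
    clsEnv F Γ (Hom.env (F.map f) Γ ρ hρ) (Hom.sat_env (F.map f) hΓ hρ) = clsEnv F Γ ρ hρ := by
  funext i
  refine Eq.trans (congrArg (cls F k) ?_) (cls_map F f ⟨_, ρ i, hρ i⟩)
  exact Interp.Pt.ext (Hom.mapCode_eq (F.map f) hΓ hρ i).symm rfl

variable {F} in
theorem exists_env_eq_of_clsEnv_eq {j : J} {n : ℕ} {Γ : Ctx T.sig n}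
    {ρ τ : Fin n → (F.obj j).model.V} {hρ : (F.obj j).model.Sat Γ ρ}
    {hτ : (F.obj j).model.Sat Γ τ} (h : clsEnv F Γ ρ hρ = clsEnv F Γ τ hτ) :
    ∃ (k : J) (f : j ⟶ k), Hom.env (F.map f) Γ ρ hρ = Hom.env (F.map f) Γ τ hτ := by
  have key : ∃ (k : J) (f : j ⟶ k), ∀ i, Indist (Hom.mapPt (F.map f) ⟨_, ρ i, hρ i⟩)
      (Hom.mapPt (F.map f) ⟨_, τ i, hτ i⟩) := by
    refine exists_hom_forall_fin ?_ fun i => exists_indist_of_cls_eq (congrFun h i)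
    intro i k f l g e
    rw [F.map_comp, Hom.mapPt_comp, Hom.mapPt_comp]
    exact e.map (F.map g)
  obtain ⟨k, f, e⟩ := key
  -- Testing indistinguishability against the identity gives equality of values.
  exact ⟨k, f, funext fun i => e i _ (𝟙 _)⟩

/-- The underlying interpretation of a filtered colimit. -/
def colimInterp : Interp T.sig where
  V := Set (Σ j, (F.obj j).model.Pt)
  fam S p := {v | ∃ j q w, ∃ hw : w ∈ (F.obj j).model.fam S q,
    clsEnv F (T.srtCtx S) q ((F.obj j).model.sat_of_mem S q w hw) = p ∧
      cls F j ⟨⟨S, q⟩, w, hw⟩ = v}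
  -- A union of classes avoids choosing a lift of `p`. If lifts exist, all their classes coincide by
  -- `cls_op_eq`; if none exists, the value is the empty set.
  op f p := {z | ∃ j q, ∃ hq : (F.obj j).model.Sat (T.opCtx f) q, clsEnv F (T.opCtx f) q hq = p ∧
    z ∈ cls F j ⟨_, (F.obj j).model.op f q, (F.obj j).model.op_mem f q hq⟩}

variable {F} in
theorem cls_op_eq {f : T.sig.Op} {j k : J} {p : Fin (T.sig.opArity f) → (F.obj j).model.V}
    {q : Fin (T.sig.opArity f) → (F.obj k).model.V} {hp : (F.obj j).model.Sat (T.opCtx f) p}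
    {hq : (F.obj k).model.Sat (T.opCtx f) q}
    (h : clsEnv F (T.opCtx f) p hp = clsEnv F (T.opCtx f) q hq) :
    cls F j ⟨_, (F.obj j).model.op f p, (F.obj j).model.op_mem f p hp⟩ =
      cls F k ⟨_, (F.obj k).model.op f q, (F.obj k).model.op_mem f q hq⟩ := by
  have hf := (T.wf.op f).ctx_of_ty
  -- Moving the arguments to a later stage does not change the class of the result. It then remains
  -- to find a stage where both argument lists are equal.
  have hmap : ∀ {j k : J} (g : j ⟶ k) (p : Fin (T.sig.opArity f) → (F.obj j).model.V)
      (hp : (F.obj j).model.Sat (T.opCtx f) p),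
      cls F j ⟨_, (F.obj j).model.op f p, (F.obj j).model.op_mem f p hp⟩ =
        cls F k ⟨_, _, (F.obj k).model.op_mem f _ (Hom.sat_env (F.map g) hf hp)⟩ := by
    intro j k g p hp
    refine (cls_map F g _).symm.trans (congrArg (cls F k) ?_)
    exact Interp.Pt.ext (PreHom.mapPt_ty _ (T.wf.op f) hp _) (Hom.map_op (F.map g) f p hp)
  rw [← clsEnv_env F (IsFiltered.leftToMax j k) hf hp,
    ← clsEnv_env F (IsFiltered.rightToMax j k) hf hq] at h
  obtain ⟨l, g, e⟩ := exists_env_eq_of_clsEnv_eq h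
  have hp' := Hom.sat_env (F.map (IsFiltered.leftToMax j k)) hf hp
  have hq' := Hom.sat_env (F.map (IsFiltered.rightToMax j k)) hf hq
  refine ((hmap (IsFiltered.leftToMax j k) p hp).trans (hmap g _ hp')).trans
    (Eq.trans ?_ ((hmap (IsFiltered.rightToMax j k) q hq).trans (hmap g _ hq')).symm)
  refine congrArg (cls F l) (Interp.Pt.ext ?_ ?_)
  · exact congrArg (fun r => (F.obj l).model.code r (T.opTy f)) e
  · exact congrArg ((F.obj l).model.op f) e

/-- The map of a stage to the filtered colimit. -/
def colimMap (j : J) : PreHom (F.obj j).model (colimInterp F) where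
  toFun c v hv := cls F j ⟨c, v, hv⟩
  map_mem c v hv := ⟨j, c.2, v, hv, rfl, rfl⟩
  map_op f p hp := by
    refine Set.ext fun z => ⟨fun hz => ⟨j, p, hp, rfl, hz⟩, ?_⟩
    · rintro ⟨k, q, hq, e, hz⟩
      exact cls_op_eq e ▸ hz
  -- The two points may have different semantic types, but every homomorphism gives them the same
  -- value by `map_tyAx`, so they are indistinguishable.
  map_tyAx e he ρ hρ v hl hr := (cls_eq_iff F).2
    ⟨j, 𝟙 j, 𝟙 j, fun N h => by
      rw [F.map_id]
      exact Hom.map_tyAx h e he ρ hρ v hl hr⟩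

theorem colimMap_isFilteredColimit : IsFilteredColimit (colimMap F) where
  nat j k f x := Interp.Pt.ext (congrArg (Sigma.mk x.code.1)
    (clsEnv_env F f (T.wf.srt x.code.1) ((F.obj j).model.sat_of_mem _ _ _ x.mem))) (cls_map F f x)
  surj S p v hv := hv
  inj j x y h := by
    obtain ⟨⟨S, p⟩, v, hv⟩ := x
    obtain ⟨⟨S', q⟩, w, hw⟩ := y
    obtain rfl : S = S' := congrArg (fun z => z.code.1) h
    -- Parameters and values become equal at separate stages `k` and `k'`, which are then joined.
    obtain ⟨k, f, e⟩ := exists_env_eq_of_clsEnv_eq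
      (eq_of_heq (Sigma.mk.inj (congrArg Interp.Pt.code h)).2)
    obtain ⟨k', f', e'⟩ := exists_indist_of_cls_eq (congrArg Interp.Pt.val h)
    obtain ⟨l, g, g', eg⟩ := IsFiltered.span f f'
    refine ⟨l, f ≫ g, Interp.Pt.ext ?_ ?_⟩
    · rw [F.map_comp, Hom.mapPt_comp, Hom.mapPt_comp]
      exact PreHom.mapPt_code_congr _ (congrArg (Sigma.mk S) e)
    · rw [eg, F.map_comp, Hom.mapPt_comp, Hom.mapPt_comp]
      exact e' _ (F.map g')

/-- The filtered colimit cocone. -/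
noncomputable def filteredCocone : Cocone F where
  pt := ⟨(colimMap_isFilteredColimit F).model⟩
  ι :=
    { app j := (⟨(colimMap F j).toFun, (colimMap F j).map_mem, (colimMap F j).map_op,
        (colimMap F j).map_tyAx⟩ : Hom (F.obj j).model (colimMap_isFilteredColimit F).model)
      naturality j k f := by
        refine Eq.trans ?_ (Category.comp_id _).symm
        refine Hom.ext (funext fun c => funext fun v => funext fun hv => ?_)
        exact cls_map F f ⟨c, v, hv⟩ }

theorem filteredCocone_isFilteredColimit : IsFilteredColimit fun j =>
    Hom.toPreHom (M := (F.obj j).model) (N := (filteredCocone F).pt.model)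
      ((filteredCocone F).ι.app j) :=
  colimMap_isFilteredColimit F

instance elts_preservesFilteredColimits (S : T.sig.Srt) :
    PreservesFilteredColimits (elts T S) where
  preserves_filtered_colimits J _ _ := ⟨fun {F} => preservesColimit_of_preserves_colimit_cocone
    (filteredCocone_isFilteredColimit F).isColimit <| by
      have h := filteredCocone_isFilteredColimit F
      refine Types.FilteredColimit.isColimitOf' _ _ (fun x => ?_) (fun j x y e => ?_)
      · obtain ⟨⟨p, v⟩, hv⟩ := x
        obtain ⟨j, q, w, hw, rfl, rfl⟩ := h.surj S p v hv
        exact ⟨j, ⟨(q, w), hw⟩, rfl⟩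
      · obtain ⟨k, f, e⟩ := h.inj j (toPt x) (toPt y) (congrArg toPt e)
        exact ⟨k, f, toPt_injective e⟩⟩

end Alg

/-! ### The forgetful functor preserves filtered colimits. -/

/-- An element of a model, seen in the underlying model of the smaller theory. -/
def Extension.forgetPt {T : GAT.{u}} (E : Extension T) {M : E.theory.Alg} (x : M.model.Pt) :
    (E.forget.obj M).model.Pt :=
  ⟨x.code, x.val, x.mem⟩

theorem Extension.mapPt_forgetPt {T : GAT.{u}} (E : Extension T) {M N : E.theory.Alg}
    (h : M ⟶ N) (x : M.model.Pt) :
    Hom.mapPt (E.forget.map h) (E.forgetPt x) = E.forgetPt (Hom.mapPt h x) :=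
  Interp.Pt.ext (congrArg (Sigma.mk x.code.1) (mapEnv_forget (M := M.model) (N := N.model) h
    (T.srtCtx x.code.1) x.code.2 (M.model.sat_of_mem _ _ _ x.mem) _).symm) rfl

/-- An element of the underlying model of the smaller theory, seen in the model itself. -/
def Extension.ofForgetPt {T : GAT.{u}} (E : Extension T) {M : E.theory.Alg}
    (x : (E.forget.obj M).model.Pt) : M.model.Pt :=
  ⟨x.code, x.val, x.mem⟩

theorem Extension.mapPt_ofForgetPt {T : GAT.{u}} (E : Extension T) {M N : E.theory.Alg}
    (h : M ⟶ N) (x : (E.forget.obj M).model.Pt) :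
    Hom.mapPt (E.forget.map h) x = E.forgetPt (Hom.mapPt h (E.ofForgetPt x)) :=
  E.mapPt_forgetPt h (E.ofForgetPt x)

/-- Since there are no new sorts, a model and its underlying model have the same points. The
condition `IsFilteredColimit` therefore passes from `T'` to `T`, and it suffices for a colimit in
either category. -/
instance Extension.forget_preservesFilteredColimits {T : GAT.{u}} (E : Extension T) :
    PreservesFilteredColimits E.forget where
  preserves_filtered_colimits J _ _ := ⟨fun {F} => preservesColimit_of_preserves_colimit_cocone
    (Alg.filteredCocone_isFilteredColimit F).isColimit <| by
      have h := Alg.filteredCocone_isFilteredColimit F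
      refine IsFilteredColimit.isColimit ⟨fun j k f x => ?_, fun S p v hv => ?_, fun j x y e => ?_⟩
      · refine (congrArg (Hom.mapPt (E.forget.map ((Alg.filteredCocone F).ι.app k)))
          (E.mapPt_ofForgetPt (F.map f) x)).trans ?_
        refine (E.mapPt_forgetPt ((Alg.filteredCocone F).ι.app k) _).trans ?_
        exact (congrArg E.forgetPt (h.nat f (E.ofForgetPt x))).trans
          (E.mapPt_ofForgetPt ((Alg.filteredCocone F).ι.app j) x).symm
      · obtain ⟨j, q, w, hw, rfl, rfl⟩ := h.surj S p v hv
        exact ⟨j, q, w, hw, (mapEnv_forget (M := (F.obj j).model)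
          (N := (Alg.filteredCocone F).pt.model) ((Alg.filteredCocone F).ι.app j) (T.srtCtx S) q
          ((F.obj j).model.sat_of_mem S q w hw) _).symm, rfl⟩
      · have e' : E.forgetPt (Hom.mapPt ((Alg.filteredCocone F).ι.app j) (E.ofForgetPt x)) =
            E.forgetPt (Hom.mapPt ((Alg.filteredCocone F).ι.app j) (E.ofForgetPt y)) :=
          (E.mapPt_ofForgetPt _ x).symm.trans (e.trans (E.mapPt_ofForgetPt _ y))
        obtain ⟨k, f, e''⟩ := h.inj j _ _ (congrArg E.ofForgetPt e')
        exact ⟨k, f, (E.mapPt_ofForgetPt _ x).trans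
          ((congrArg E.forgetPt e'').trans (E.mapPt_ofForgetPt _ y).symm)⟩⟩

/-! ## An adjoint functor theorem for locally finitely presentable categories -/

/-- A functor on a category with a small dense subcategory has a right adjoint if it preserves the
canonical colimits and the colimits of its categories of costructured arrows. -/
theorem isLeftAdjoint_of_isDense {A C D : Type*} [Category* A] [Category* C] [Category* D]
    (K : A ⥤ C) [K.IsDense] (U : C ⥤ D)
    [∀ Y, PreservesColimitsOfShape (CostructuredArrow K Y) U]
    [∀ Z, HasColimitsOfShape (CostructuredArrow (K ⋙ U) Z) C]
    [∀ Z, PreservesColimitsOfShape (CostructuredArrow (K ⋙ U) Z) U] : U.IsLeftAdjoint := by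
  refine isLeftAdjoint_iff_hasTerminal_costructuredArrow.2 fun Z => ?_
  let Φ : CostructuredArrow (K ⋙ U) Z ⥤ C := CostructuredArrow.proj (K ⋙ U) Z ⋙ K
  let t : Cocone (Φ ⋙ U) :=
    { pt := Z
      ι := { app j := j.hom
             naturality i j f :=
              (CostructuredArrow.w f).trans (Category.comp_id _).symm } }
  let hX := isColimitOfPreserves U (colimit.isColimit Φ)
  -- The pair of `colimit Φ` and `a` is shown to be terminal among pairs `(Y, g : U.obj Y ⟶ Z)`, so
  -- `a` is the counit at `Z`.
  let a : U.obj (colimit Φ) ⟶ Z := hX.desc t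
  have ha : ∀ j, U.map (colimit.ι Φ j) ≫ a = j.hom := fun j => hX.fac t j
  -- A map `h : K.obj k ⟶ Y` makes `k` an index of `Φ` by way of `U.map h ≫ g`. The resulting
  -- coprojections form a cocone on the canonical diagram of `Y`, and density turns it into `lift
  -- g`.
  let leg : ∀ {Y : C} (_ : U.obj Y ⟶ Z) (k : A) (_ : K.obj k ⟶ Y), K.obj k ⟶ colimit Φ :=
    fun g k h => colimit.ι Φ (CostructuredArrow.mk (S := K ⋙ U) (Y := k) (U.map h ≫ g))
  have hleg : ∀ {Y : C} (g : U.obj Y ⟶ Z) {k l : A} (f : k ⟶ l) (h : K.obj l ⟶ Y),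
      K.map f ≫ leg g l h = leg g k (K.map f ≫ h) := by
    intro Y g k l f h
    exact colimit.w Φ (CostructuredArrow.homMk
      (f := CostructuredArrow.mk (S := K ⋙ U) (U.map (K.map f ≫ h) ≫ g))
      (f' := CostructuredArrow.mk (S := K ⋙ U) (U.map h ≫ g)) f (by simp))
  let c : ∀ {Y : C} (_ : U.obj Y ⟶ Z), Cocone (CostructuredArrow.proj K Y ⋙ K) := fun {Y} g =>
    { pt := colimit Φ
      ι := { app j := leg g j.left j.hom
             naturality i j f := by
              have := hleg g f.left j.hom
              rw [CostructuredArrow.w f] at this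
              exact this.trans (Category.comp_id _).symm } }
  let dc : ∀ Y, Cocone (CostructuredArrow.proj K Y ⋙ K) := fun Y =>
    { pt := Y
      ι := { app j := j.hom
             naturality i j f :=
              (CostructuredArrow.w f).trans (Category.comp_id _).symm } }
  let hd : ∀ Y, IsColimit (dc Y) := fun Y =>
    (K.denseAt Y).ofIsoColimit (Cocone.ext (Iso.refl _) fun j =>
      (Category.comp_id _).trans (Category.id_comp _))
  let lift : ∀ {Y : C} (_ : U.obj Y ⟶ Z), (Y ⟶ colimit Φ) := fun {Y} g =>
    (hd Y).desc (c g)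
  have hlift : ∀ {Y : C} (g : U.obj Y ⟶ Z) {k : A} (h : K.obj k ⟶ Y), h ≫ lift g = leg g k h :=
    fun {Y} g {k} h => (hd Y).fac (c g) (CostructuredArrow.mk h)
  -- At a coprojection `j`, the leg of `a` has index `U.map (colimit.ι Φ j) ≫ a = j.hom`, so it is
  -- that coprojection again.
  have hid : lift a = 𝟙 _ := by
    refine colimit.hom_ext fun j => ?_
    refine (hlift a (colimit.ι Φ j)).trans ?_
    rw [Category.comp_id]
    dsimp only [leg]
    rw [ha]
    rfl
  have hom_ext : ∀ {Y : C} {p q : Y ⟶ colimit Φ}, (∀ k (h : K.obj k ⟶ Y), h ≫ p = h ≫ q) →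
      p = q := fun {Y p q} h => (hd Y).hom_ext fun j => h _ j.hom
  have hla : ∀ {Y : C} (g : U.obj Y ⟶ Z), U.map (lift g) ≫ a = g := by
    intro Y g
    refine (isColimitOfPreserves U (hd Y)).hom_ext fun j => ?_
    have h1 := hlift g j.hom
    have h2 := ha (CostructuredArrow.mk (S := K ⋙ U) (Y := j.left) (U.map j.hom ≫ g))
    change U.map j.hom ≫ U.map (lift g) ≫ a = U.map j.hom ≫ g
    rw [← U.map_comp_assoc, h1]
    exact h2
  have hT : IsTerminal (CostructuredArrow.mk a) := IsTerminal.ofUniqueHom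
    (fun Y => CostructuredArrow.homMk (lift Y.hom) (hla Y.hom)) fun Y m => by
      refine CostructuredArrow.hom_ext _ _ (hom_ext fun k h => ?_)
      have hm : U.map m.left ≫ a = Y.hom := CostructuredArrow.w m
      -- Uniqueness: as `lift a` is the identity, `h ≫ m.left` is a coprojection. Its index is
      -- `U.map (h ≫ m.left) ≫ a = U.map h ≫ Y.hom`, the one used by `lift Y.hom`.
      have e : h ≫ m.left = leg a k (h ≫ m.left) := by
        rw [← hlift a (h ≫ m.left), hid, Category.comp_id]
      refine e.trans (Eq.trans ?_ (hlift Y.hom h).symm)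
      let leg' : (U.obj (K.obj k) ⟶ Z) → (K.obj k ⟶ colimit Φ) := fun g =>
        colimit.ι Φ (CostructuredArrow.mk (S := K ⋙ U) (Y := k) g)
      refine congrArg leg' ?_
      rw [U.map_comp, Category.assoc, hm]
  exact hT.hasTerminal

/-- Closing the generator under finite colimits makes both index categories in
`isLeftAdjoint_of_isDense` filtered. The target category needs no colimits of its own. -/
theorem isLeftAdjoint_of_isStrongGenerator {C D : Type (u + 1)} [Category.{u} C] [Category.{u} D]
    [HasColimits C] {P : ObjectProperty C} [ObjectProperty.Small.{u} P]
    (hP : P.IsStrongGenerator) (hP' : P ≤ ObjectProperty.isFinitelyPresentable.{u} C)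
    (U : C ⥤ D) [PreservesFiniteColimits U] [PreservesFilteredColimits U] :
    U.IsLeftAdjoint := by
  have := Cardinal.fact_isRegular_aleph0.{u}
  let R := P.colimitsCardinalClosure Cardinal.aleph0.{u}
  have : R.ι.IsDense := hP.isDense_colimitsCardinalClosure_ι hP'
  have hR : ∀ (J : Type) [SmallCategory J] [FinCategory J], R.IsClosedUnderColimitsOfShape J := by
    intro J _ _
    refine ObjectProperty.isClosedUnderColimitsOfShape_colimitsCardinalClosure _ _ J ?_
    simp only [hasCardinalLT_aleph0_iff]
    infer_instance
  have : HasFiniteColimits R.FullSubcategory := ⟨fun J _ _ => by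
    have := hR J
    infer_instance⟩
  have : PreservesFiniteColimits R.ι := ⟨fun J _ _ => by
    have := hR J
    infer_instance⟩
  -- The comma categories live in `Type (u + 1)` but are essentially small, so facts about small
  -- filtered colimits transfer along an equivalence.
  have key : ∀ (J : Type (u + 1)) [Category.{u} J] [IsFiltered J] [EssentiallySmall.{u} J],
      HasColimitsOfShape J C ∧ PreservesColimitsOfShape J U := by
    intro J _ _ _
    have := IsFiltered.of_equivalence (equivSmallModel.{u} J)
    exact ⟨hasColimitsOfShape_of_equivalence (equivSmallModel.{u} J).symm,
      preservesColimitsOfShape_of_equiv (equivSmallModel.{u} J).symm U⟩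
  have : PreservesFiniteColimits (R.ι ⋙ U) := comp_preservesFiniteColimits _ _
  have h₁ : ∀ Y, IsFiltered (CostructuredArrow R.ι Y) := fun Y => inferInstance
  have h₂ : ∀ Z, IsFiltered (CostructuredArrow (R.ι ⋙ U) Z) := fun Z =>
    IsFiltered.of_hasFiniteColimits _
  have := fun Y => (key (CostructuredArrow R.ι Y)).2
  have := fun Z => (key (CostructuredArrow (R.ι ⋙ U) Z)).1
  have := fun Z => (key (CostructuredArrow (R.ι ⋙ U) Z)).2
  exact isLeftAdjoint_of_isDense R.ι U

/-! ## Generators of the category of models -/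

namespace Alg

variable {T : GAT.{u}}

/-- The free model on an element of the sort `S`. -/
noncomputable def generator (S : T.sig.Srt) : T.Alg := (elts T S).leftAdjoint.obj PUnit

/-- Maps from the generator are elements. -/
noncomputable def generatorEquiv (S : T.sig.Srt) (M : T.Alg) :
    (generator S ⟶ M) ≃ (elts T S).obj M :=
  ((Adjunction.ofIsRightAdjoint (elts T S)).homEquiv PUnit M).trans
    ⟨fun f => f ⟨⟩, fun x => ↾fun _ => x, fun _ => rfl, fun _ => rfl⟩

theorem generatorEquiv_comp (S : T.sig.Srt) {M N : T.Alg} (f : generator S ⟶ M) (g : M ⟶ N) :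
    generatorEquiv S N (f ≫ g) = (elts T S).map g (generatorEquiv S M f) :=
  congrArg (fun h : PUnit ⟶ (elts T S).obj N => h ⟨⟩)
    (Adjunction.homEquiv_naturality_right _ f g)

/-- The generators. -/
def generators (T : GAT.{u}) : ObjectProperty T.Alg := .ofObj (generator (T := T))

/-- A left adjoint preserves finitely presentable objects when its right adjoint preserves filtered
colimits; the one-point set is finitely presentable. -/
theorem generators_le_isFinitelyPresentable :
    generators T ≤ ObjectProperty.isFinitelyPresentable.{u} T.Alg := by
  have := Cardinal.fact_isRegular_aleph0.{u}
  rintro _ ⟨S⟩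
  have h1 : (elts T S).IsCardinalAccessible Cardinal.aleph0.{u} :=
    Functor.isFinitelyAccessible_iff_preservesFilteredColimits.2 inferInstance
  have h2 : IsCardinalPresentable (PUnit.{u + 1} : Type u) Cardinal.aleph0.{u} :=
    HasCardinalLT.isCardinalPresentable (by
      simp only [hasCardinalLT_aleph0_iff]; infer_instance)
  exact (Adjunction.ofIsRightAdjoint (elts T S)).isCardinalPresentable_leftAdjoint_obj
    Cardinal.aleph0.{u} PUnit

theorem hom_ext_elts {M N : T.Alg} {f g : M ⟶ N}
    (h : ∀ S (x : (elts T S).obj M), (elts T S).map f x = (elts T S).map g x) : f = g :=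
  Hom.ext_mapPt fun x => congrArg toPt (h x.code.1 ⟨(x.code.2, x.val), x.mem⟩)

theorem isIso_of_bijective_elts {M N : T.Alg} (i : M ⟶ N)
    (h : ∀ S, Function.Bijective ((elts T S).map i)) : IsIso i := by
  -- Over a one-object index category, `i` is a cocone, and bijectivity on elements says that it is
  -- a filtered colimit. Descending the identity cocone then gives the inverse of `i`.
  let F : Discrete PUnit.{u + 1} ⥤ T.Alg := (Functor.const _).obj M
  let c : Cocone F := { pt := N, ι := { app _ := i } }
  have hc : IsColimit c := IsFilteredColimit.isColimit
    { nat j k f x := rfl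
      surj S p v hv := by
        obtain ⟨⟨⟨q, w⟩, hw⟩, e⟩ := (h S).2 ⟨(p, v), hv⟩
        exact ⟨⟨⟨⟩⟩, q, w, hw, congrArg (fun x => x.1.1) e, congrArg (fun x => x.1.2) e⟩
      inj j x y e := by
        refine ⟨j, 𝟙 j, ?_⟩
        obtain ⟨⟨S, p⟩, v, hv⟩ := x
        obtain ⟨⟨S', q⟩, w, hw⟩ := y
        obtain rfl : S = S' := congrArg (fun z => z.code.1) e
        exact congrArg toPt (@(h S).1 ⟨(p, v), hv⟩ ⟨(q, w), hw⟩ (toPt_injective e)) }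
  let s : Cocone F := { pt := M, ι := { app _ := 𝟙 M } }
  have h₁ : i ≫ hc.desc s = 𝟙 M := hc.fac s ⟨⟨⟩⟩
  refine ⟨hc.desc s, h₁, hc.hom_ext fun j => ?_⟩
  exact (Category.assoc _ _ _).symm.trans ((congrArg (· ≫ i) h₁).trans
    ((Category.id_comp i).trans (Category.comp_id i).symm))

/-- Maps out of `generator S` are elements of `S`. For a monomorphism through which all such maps
factor, injectivity on elements comes from the monomorphism and surjectivity from the
factorizations. -/
theorem generators_isStrongGenerator : (generators T).IsStrongGenerator := by
  refine ObjectProperty.isStrongGenerator_iff.2 ⟨fun M N f g h => ?_, fun M N i _ h => ?_⟩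
  · refine hom_ext_elts fun S x => ?_
    obtain ⟨k, rfl⟩ := (generatorEquiv S M).surjective x
    rw [← generatorEquiv_comp, ← generatorEquiv_comp, h _ ⟨S⟩ k]
  · refine isIso_of_bijective_elts i fun S => ⟨fun x y e => ?_, fun y => ?_⟩
    · obtain ⟨k, rfl⟩ := (generatorEquiv S M).surjective x
      obtain ⟨l, rfl⟩ := (generatorEquiv S M).surjective y
      rw [← generatorEquiv_comp, ← generatorEquiv_comp] at e
      rw [(cancel_mono i).1 ((generatorEquiv S N).injective e)]
    · obtain ⟨k, rfl⟩ := (generatorEquiv S N).surjective y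
      obtain ⟨l, rfl⟩ := h _ ⟨S⟩ k
      exact ⟨_, (generatorEquiv_comp S l i).symm⟩

instance : ObjectProperty.Small.{u} (generators T) := by
  dsimp only [generators]
  infer_instance

end Alg

end GATheory


theorem mainTheorem2 (T : GATheory.GAT.{u}) (E : GATheory.Extension T) :
    E.forget.IsLeftAdjoint ↔ CategoryTheory.Limits.PreservesFiniteColimits E.forget :=
  ⟨fun _ => inferInstance, fun _ => GATheory.isLeftAdjoint_of_isStrongGenerator
    GATheory.Alg.generators_isStrongGenerator
    GATheory.Alg.generators_le_isFinitelyPresentable E.forget⟩
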